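/- Let $G=(V,D,B)$ be an acyclic mixed graph on a finite node set $V$: $D\subseteq V\times V$ is a set of directed edges $u\to v$ without directed cycles, and $B$ is a set of bidirected edges $u\leftrightarrow v$ with $u\ne v$. Write $\mathrm{pa}(v)=\{w : w\to v\in D\}$ and $\mathrm{sib}(v)=\{w : w\leftrightarrow v\in B\}$. **HTC-identifiability.** A trek from $v_l$ to $u_r$ ($l,r\ge 1$) is a walk $v_l\leftarrow\cdots\leftarrow v_1\leftrightarrow u_1\to\cdots\to u_r$ or $v_l\leftarrow\cdots\leftarrow v_1=u_1\to\cdots\to u_r$ with $v_1,\dots,v_l$ pairwise distinct and $u_1,\dots,u_r$ pairwise distinct; its left side is $\{v_1,\dots,v_l\}$, its right side is $\{u_1,\dots,u_r\}$, and its length is $1+(l-1)+(r-1)$. A half-trek is a trek with $l=1$. Let $\mathrm{htr}(v)$ be the set of $w\notin\{v\}\cup\mathrm{sib}(v)$ such that there is a half-trek from $v$ to $w$. A set $Y\subseteq V$ satisfies the half-trek criterion with respect to $v$ if $|Y|=|\mathrm{pa}(v)|$, $Y\cap(\{v\}\cup\mathrm{sib}(v))=\emptyset$, and there are half-treks, one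 from each $y\in Y$, whose end points are in bijection with $\mathrm{pa}(v)$ and whose left sides and whose right sides are pairwise disjoint. $G$ is HTC-identifiable if there are sets $Y_v$ ($v\in V$), each satisfying the half-trek criterion with respect to $v$, and a total order $\prec$ on $V$ with $w\prec v$ whenever $w\in Y_v\cap\mathrm{htr}(v)$. **Identifying polynomials.** Let $\theta$ consist of indeterminates $\lambda_{uv}$ ($u\to v\in D$), $\omega_{uv}=\omega_{vu}$ ($u\leftrightarrow v\in B$) and $\omega_{vv}$ ($v\in V$), and let $\sigma$ consist of indeterminates $\sigma_{uv}=\sigma_{vu}$ ($u,v\in V$). Let $\Lambda,\Omega$ be the matrices with entries $\lambda_{uv}$, $\omega_{uv}$ (and $0$ where there is no such indeterminate), let $\tau_G(\sigma_{uv})=[(I-\Lambda)^{-\top}\Omega(I-\Lambda)^{-1}]_{uv}\in\mathbb R[\theta]$, and let $\mathcal I\subseteq\mathbb R[\theta,\sigma]$ be the ideal generated by all $\sigma_{uv}-\tau_G(\sigma_{uv})$. Given a total order $\prec$ on $\theta$, an identifying polynomial for $q\in\theta$ is a $g_q\in\mathcal I$ of the form $g_q=q\,a-b$ with $a,b\in\mathbb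 R[T,\sigma]$ for some $T\subseteq\{s\in\theta: s\prec q\}$, and $a\notin\mathcal I$. The order $\prec$ is an identifying order if every $q\in\theta$ has an identifying polynomial. **The algorithm.** The trek weighting $w$ gives weight $1$ to each $q\in\theta$ and to a new variable $h$, and gives $\sigma_{uv}$ the maximal length of a trek between $u$ and $v$ ($1$ if there is none); $w_{\mathrm{trek}}$ is the maximal length of a trek in $G$. Let $\mathcal I^{\mathrm{wh}}\subseteq\mathbb R[\theta,\sigma,h]$ be generated by the $w$-homogenizations, with respect to $h$, of all elements of $\mathcal I$. Algorithm 1 with maximal degree $d$ starts with $\theta_{\mathrm{id}}=\emptyset$ and repeats the following pass until $\theta_{\mathrm{id}}=\theta$ or a pass changes nothing. For $k=1,\dots,d\cdot w_{\mathrm{trek}}$ and for each $q\in\theta_{\mathrm{rem}}=\theta\setminus\theta_{\mathrm{id}}$, it takes a monomial order that compares first by $w$-degree, then lexicographically in the variables $\theta_{\mathrm{rem}}$, of which $q$ is the smallest, then by some monomial order in the other variables; it computes the elements of $w$-degree at most $k$ of the reduced Gröbner basis of $\mathcal I^{\mathrm{wh}}$ for this order. If they include a homogenized identifying polynomial for some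 $q'\in\theta_{\mathrm{rem}}$, that is, an element $q'a-b$ of $\mathcal I^{\mathrm{wh}}$ with $a,b\in\mathbb R[\theta_{\mathrm{id}},\sigma,h]$ and $a\notin\mathcal I^{\mathrm{wh}}$, then it adds $q'$ to $\theta_{\mathrm{id}}$ and ends the pass. It returns "yes" if finally $\theta_{\mathrm{id}}=\theta$, and "no" otherwise. **Proposition.** Let $G$ be HTC-identifiable, and let $s\ge 1$ be an integer with $|\mathrm{pa}(v)|\le s$ for all $v\in V$. Then there are an identifying order $\prec$ on $\theta$ and corresponding identifying polynomials $g_q$ ($q\in\theta$), all of total degree at most $2s+1$. Moreover, for every integer $d\ge 2s+1$, Algorithm 1 with maximal degree $d$ returns "yes" for $G$, whatever loop sequences and monomial orders of the above kind it uses. -/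

import Mathlib

open MvPolynomial

universe u

/-- An acyclic mixed graph on the node set `V`: a set of directed edges without directed cycles,
and a set of bidirected edges, which is symmetric and has no self-loops. -/
structure MixedGraph (V : Type u) where
  /-- `dir v w` means `v → w`. -/
  dir : V → V → Prop
  /-- `bi.Adj v w` means `v ↔ w`. -/
  bi : SimpleGraph V
  acyclic : ∀ v, ¬ Relation.TransGen dir v v

namespace MixedGraph

variable {V : Type u} (G : MixedGraph V)

/-- The parents of a node. -/
def pa (v : V) : Set V := {w | G.dir w v}

/-! ## Treks and the half-trek criterion -/

/-- The node lists `L = [v₁, …, v_l]` and `R = [u₁, …, u_r]` form a trek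
`u = v_l ← ⋯ ← v₁ ↔ u₁ → ⋯ → u_r = v` or `u = v_l ← ⋯ ← v₁ = u₁ → ⋯ → u_r = v`.
The left side of the trek consists of the nodes in `L`, the right side of those in `R`. -/
def IsTrek (L R : List V) (u v : V) : Prop :=
  L.IsChain G.dir ∧ R.IsChain G.dir ∧ L.Nodup ∧ R.Nodup ∧
    L.getLast? = some u ∧ R.getLast? = some v ∧
    ∃ a b, L.head? = some a ∧ R.head? = some b ∧ (a = b ∨ G.bi.Adj a b)

/-- A half-trek from `u` to `v` with right side `R`: a trek whose left side is `{u}`. -/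
def IsHalfTrek (R : List V) (u v : V) : Prop := G.IsTrek [u] R u v

/-- The set `htr(v)` of nodes that are half-trek reachable from `v`, not counting `v` and
its siblings. -/
def htr (v : V) : Set V := {w | w ≠ v ∧ ¬ G.bi.Adj v w ∧ ∃ R, G.IsHalfTrek R v w}

/-- `Y` satisfies the half-trek criterion with respect to `v`: it has as many elements as `v` has
parents, it contains neither `v` nor a sibling of `v`, and there is a system of half-treks
with no sided intersection from `Y` to the parents of `v` (here `y ∈ Y` is the source of the
half-trek to `t y` with right side `R y`; the left sides `{y}` are disjoint since the sources are
distinct). -/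
def SatisfiesHTC (Y : Set V) (v : V) : Prop :=
  Y.ncard = (G.pa v).ncard ∧ (∀ y ∈ Y, y ≠ v ∧ ¬ G.bi.Adj y v) ∧
    ∃ (t : V → V) (R : V → List V), Set.BijOn t Y (G.pa v) ∧
      (∀ y ∈ Y, G.IsHalfTrek (R y) y (t y)) ∧
      ∀ y ∈ Y, ∀ y' ∈ Y, y ≠ y' → (R y).Disjoint (R y')

/-- `G` is certified by the recursive half-trek criterion. -/
def HTCIdentifiable : Prop :=
  ∃ (Y : V → Set V) (r : V → V → Prop), IsStrictTotalOrder V r ∧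
    (∀ v, G.SatisfiesHTC (Y v) v) ∧ ∀ v, ∀ w ∈ Y v ∩ G.htr v, r w v

/-! ## The parametrization and its ideal -/

/-- The parameters `θ = λ ∪ ω`: one `λ_{uv}` for each directed edge `u → v`, one `ω_{uv} = ω_{vu}`
for each bidirected edge and one `ω_{vv}` for each node. -/
abbrev Param : Type u :=
  {e : V × V // G.dir e.1 e.2} ⊕ {e : Sym2 V // e.IsDiag ∨ e ∈ G.bi.edgeSet}

/-- The variables `θ ∪ σ`, with one `σ_{uv} = σ_{vu}` for each unordered pair of (possibly
equal) nodes. -/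
abbrev Var : Type u := G.Param ⊕ Sym2 V

/-- The variables `θ ∪ σ ∪ {h}`, where `h` is `none`. -/
abbrev HVar : Type u := Option G.Var

open Classical in
/-- The matrix `Λ` of indeterminates. -/
noncomputable def Lam : Matrix V V (MvPolynomial G.Param ℝ) :=
  Matrix.of fun u v => if h : G.dir u v then X (Sum.inl ⟨(u, v), h⟩) else 0

open Classical in
/-- The entry of `Ω` at an unordered pair of nodes. -/
noncomputable def omegaEntry (e : Sym2 V) : MvPolynomial G.Param ℝ :=
  if h : e.IsDiag ∨ e ∈ G.bi.edgeSet then X (Sum.inr ⟨e, h⟩) else 0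

/-- The matrix `Ω` of indeterminates. -/
noncomputable def Omega : Matrix V V (MvPolynomial G.Param ℝ) :=
  Matrix.of fun u v => G.omegaEntry s(u, v)

variable [Fintype V] [DecidableEq V]

/-- The matrix `(I - Λ)^{-⊤} Ω (I - Λ)⁻¹`; the inverse exists over the polynomial ring because `G`
is acyclic. -/
noncomputable def covMatrix : Matrix V V (MvPolynomial G.Param ℝ) :=
  ((1 - G.Lam)⁻¹).transpose * G.Omega * (1 - G.Lam)⁻¹

theorem covMatrix_symm (u v : V) : G.covMatrix u v = G.covMatrix v u := by
  have hO : G.Omega.transpose = G.Omega := by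
    ext u v
    simp [Omega, Sym2.eq_swap]
  have h : G.covMatrix.transpose = G.covMatrix := by
    simp only [covMatrix, Matrix.transpose_mul, Matrix.transpose_transpose, hO, Matrix.mul_assoc]
  calc G.covMatrix u v = G.covMatrix.transpose v u := rfl
    _ = G.covMatrix v u := by rw [h]

/-- The image `τ_G(σ_{uv})`. -/
noncomputable def tau (e : Sym2 V) : MvPolynomial G.Param ℝ :=
  Sym2.lift ⟨fun u v => G.covMatrix u v, G.covMatrix_symm⟩ e

/-- The ideal `I` of the graph of the parametrization, generated by all
`σ_{uv} - τ_G(σ_{uv})`. -/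
noncomputable def graphIdeal : Ideal (MvPolynomial G.Var ℝ) :=
  Ideal.span (Set.range fun e : Sym2 V => X (Sum.inr e) - rename Sum.inl (G.tau e))

/-! ## Identifying polynomials -/

/-- `g` is an identifying polynomial for `q` with respect to the order `r` on the parameters:
`g = q a - b` lies in the ideal, where `a` and `b` involve only `σ` and a set `T` of parameters that
precede `q`, and `a` is not in the ideal. -/
def IsIdentifyingPolynomial (r : G.Param → G.Param → Prop) (q : G.Param)
    (g : MvPolynomial G.Var ℝ) : Prop :=
  g ∈ G.graphIdeal ∧ ∃ T : Set G.Param, (∀ s ∈ T, r s q) ∧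
    ∃ a ∈ supported ℝ (Sum.inl '' T ∪ Set.range Sum.inr : Set G.Var),
    ∃ b ∈ supported ℝ (Sum.inl '' T ∪ Set.range Sum.inr : Set G.Var),
      g = X (Sum.inl q) * a - b ∧ a ∉ G.graphIdeal

/-- `r` is an identifying order, that is, a total order on the parameters for which every parameter
has an identifying polynomial, and `P` is a corresponding set of identifying polynomials. -/
def IsIdentifyingOrderWith (r : G.Param → G.Param → Prop)
    (P : G.Param → MvPolynomial G.Var ℝ) : Prop :=
  IsStrictTotalOrder G.Param r ∧ ∀ q, G.IsIdentifyingPolynomial r q (P q)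

/-! ## The trek weighting and the homogenized ideal -/

/-- The lengths of the treks between the two nodes of `e`, where the length of a trek is the total
degree of its monomial `ω_{v₁u₁} ∏ λ_{v_k v_{k+1}} ∏ λ_{u_k u_{k+1}}`, i.e. `1 + (l - 1) + (r - 1)`
for a trek with sides of `l ≥ 1` and `r ≥ 1` nodes. -/
def trekLengths (e : Sym2 V) : Set ℕ :=
  {n | ∃ L R u v, e = s(u, v) ∧ G.IsTrek L R u v ∧ n = 1 + (L.length - 1) + (R.length - 1)}

theorem trekLengths_bddAbove (e : Sym2 V) : BddAbove (G.trekLengths e) := by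
  refine ⟨1 + Fintype.card V + Fintype.card V, ?_⟩
  rintro n ⟨L, R, u, v, -, ⟨-, -, hL, hR, -⟩, rfl⟩
  have h1 := hL.length_le_card
  have h2 := hR.length_le_card
  omega

open Classical in
/-- The trek weighting on `θ ∪ σ`: parameters have weight `1`, and `σ_{uv}` has as weight the maximal
length of a trek between `u` and `v`, or `1` if there is none. -/
noncomputable def trekWeight : G.Var → ℕ
  | Sum.inl _ => 1
  | Sum.inr e => if (G.trekLengths e).Nonempty then sSup (G.trekLengths e) else 1

/-- The trek weighting extended to `θ ∪ σ ∪ {h}`, where `h` has weight `1`. -/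
noncomputable def trekWeightH : G.HVar → ℕ
  | none => 1
  | some x => G.trekWeight x

/-- The length of the longest trek in `G`. -/
noncomputable def maxTrekLength : ℕ := sSup (⋃ e, G.trekLengths e)

/-- The weighted homogenization of `f` with respect to the trek weighting: every monomial is multiplied
by the power of `h` that raises its weighted degree to that of `f`. -/
noncomputable def homogenize (f : MvPolynomial G.Var ℝ) : MvPolynomial G.HVar ℝ :=
  ∑ m ∈ f.support, monomial
    (m.mapDomain some + Finsupp.single none
      (weightedTotalDegree G.trekWeight f - Finsupp.weight G.trekWeight m)) (coeff m f)

/-- The homogenized ideal, generated by the homogenizations of all elements of the ideal. -/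
noncomputable def homIdeal : Ideal (MvPolynomial G.HVar ℝ) :=
  Ideal.span (G.homogenize '' (G.graphIdeal : Set (MvPolynomial G.Var ℝ)))

/-- `g` is a homogenized identifying polynomial for `q`, given the set `S` of parameters that have
already been identified. -/
def IsHomIdentifyingPolynomial (S : Set G.Param) (q : G.Param) (g : MvPolynomial G.HVar ℝ) : Prop :=
  g ∈ G.homIdeal ∧
    ∃ a ∈ supported ℝ ((some ∘ Sum.inl) '' Sᶜ : Set G.HVar)ᶜ,
    ∃ b ∈ supported ℝ ((some ∘ Sum.inl) '' Sᶜ : Set G.HVar)ᶜ,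
      g = X (some (Sum.inl q)) * a - b ∧ a ∉ G.homIdeal

end MixedGraph

/-! ## Gröbner bases -/

/-- `F` is a reduced Gröbner basis of the ideal `I` with respect to the monomial order `m`. -/
def IsReducedGroebnerBasis {ι : Type u} (m : MonomialOrder.{u, u} ι) (I : Ideal (MvPolynomial ι ℝ))
    (F : Finset (MvPolynomial ι ℝ)) : Prop :=
  (∀ f ∈ F, f ∈ I) ∧
    Ideal.span (m.leadingTerm '' (I : Set (MvPolynomial ι ℝ))) =
      Ideal.span (m.leadingTerm '' (F : Set (MvPolynomial ι ℝ))) ∧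
    ∀ f ∈ F, m.leadingCoeff f = 1 ∧ ∀ g ∈ F, g ≠ f → ∀ e ∈ f.support, ¬ m.degree g ≤ e

/-- The reduced Gröbner basis of `I` up to the `w`-degree `k`. The reduced Gröbner basis `F` of an ideal
in finitely many variables exists and is unique. -/
def groebnerUpTo {ι : Type u} (w : ι → ℕ) (m : MonomialOrder.{u, u} ι)
    (I : Ideal (MvPolynomial ι ℝ)) (k : ℕ) : Set (MvPolynomial ι ℝ) :=
  {f | ∃ F, IsReducedGroebnerBasis m I F ∧ f ∈ F ∧ weightedTotalDegree w f ≤ k}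

/-- `m` is a `w`-graded lex-elimination order for the block `B` of variables, such that `q` is the
smallest variable in `B`: monomials are compared first by `w`-degree, then lexicographically in
the variables in `B` with respect to some total order `r` of these variables (`r x y` means that
`x` is smaller than `y`, so `y` has priority), and then by some monomial order in the remaining
variables. -/
def IsGradedLexElim {ι : Type u} (w : ι → ℕ) (B : Set ι) (q : ι) (m : MonomialOrder.{u, u} ι) : Prop :=
  ∃ (r : B → B → Prop) (m₂ : MonomialOrder.{u, u} {x // x ∉ B}), IsStrictTotalOrder B r ∧
    (∀ y : B, (y : ι) ≠ q → ∃ hq : q ∈ B, r ⟨q, hq⟩ y) ∧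
    ∀ a b : ι →₀ ℕ, m.toSyn a < m.toSyn b ↔
      Finsupp.weight w a < Finsupp.weight w b ∨
      (Finsupp.weight w a = Finsupp.weight w b ∧
        ((∃ x : B, a x < b x ∧ ∀ y : B, r x y → a y = b y) ∨
         ((∀ x ∈ B, a x = b x) ∧
          m₂.toSyn (a.subtypeDomain (· ∉ B)) < m₂.toSyn (b.subtypeDomain (· ∉ B)))))

namespace MixedGraph

variable {V : Type u} (G : MixedGraph V) [Fintype V] [DecidableEq V]

/-! ## Degree-bounded identification -/

/-- The choices that the algorithm leaves open. For each set `S` of already identified parameters,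
the for-loops run through the remaining parameters in some sequence, and for each
weighted degree `k` and each remaining parameter `q` some graded lex-elimination order for the
remaining parameters with smallest variable `q` is used. -/
structure Choices where
  /-- sequence of the parameters in the outer loop over the remaining parameters -/
  outer : Set G.Param → ℕ → List G.Param
  mem_outer : ∀ S k q, q ∈ outer S k ↔ q ∉ S
  /-- sequence of the parameters in the inner loop over the remaining parameters -/
  inner : Set G.Param → ℕ → G.Param → List G.Param
  mem_inner : ∀ S k q q', q' ∈ inner S k q ↔ q' ∉ S
  /-- the monomial order -/
  order : Set G.Param → ℕ → G.Param → MonomialOrder.{u, u} G.HVar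
  order_spec : ∀ S k q, q ∉ S →
    IsGradedLexElim G.trekWeightH ((some ∘ Sum.inl) '' Sᶜ) (some (Sum.inl q)) (order S k q)

variable {G}

open Classical in
/-- The three nested for-loops, for the maximal degree `d`: the first parameter for which the reduced
Gröbner basis up to weighted degree `k` contains a homogenized identifying polynomial,
`k = 1, …, d * w_trek`, if there is one. -/
noncomputable def Choices.search (C : G.Choices) (d : ℕ) (S : Set G.Param) : Option G.Param :=
  (List.range' 1 (d * G.maxTrekLength)).findSome? fun k =>
    (C.outer S k).findSome? fun q =>
      (C.inner S k q).find? fun q' =>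
        decide (∃ g ∈ groebnerUpTo G.trekWeightH (C.order S k q) G.homIdeal k,
          G.IsHomIdentifyingPolynomial S q' g)

/-- One pass of the repeat-loop: the parameter that has been found, if any, is added to the set of
identified parameters. -/
noncomputable def Choices.pass (C : G.Choices) (d : ℕ) (S : Set G.Param) : Set G.Param :=
  match C.search d S with
  | none => S
  | some q => insert q S

theorem Choices.subset_pass (C : G.Choices) (d : ℕ) (S : Set G.Param) : S ⊆ C.pass d S := by
  unfold Choices.pass
  split
  · exact subset_rfl
  · exact Set.subset_insert _ _

open Classical in
/-- The repeat-loop, started with the set `S` of identified parameters: it ends when all parameters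
are identified or no change has occurred in the last pass. The value is the final set of identified
parameters. -/
noncomputable def Choices.run (C : G.Choices) (d : ℕ) (S : Set G.Param) : Set G.Param :=
  if C.pass d S = Set.univ ∨ C.pass d S = S then C.pass d S else C.run d (C.pass d S)
termination_by (Sᶜ).ncard
decreasing_by
  rename_i h
  have h2 : C.pass d S ≠ S := fun e => h (Or.inr e)
  exact Set.ncard_lt_ncard (compl_lt_compl_iff_lt.2 ((C.subset_pass d S).ssubset_of_ne h2.symm))
    (Set.toFinite _)

/-- The algorithm with maximal degree `d` starts with no identified parameter and returns "yes". -/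
def Choices.ReturnsYes (C : G.Choices) (d : ℕ) : Prop := C.run d ∅ = Set.univ

end MixedGraph

/-! The polynomials. Membership in the ideal means vanishing after σ is replaced by `tau`
(`mem_graphIdeal_iff`). Since Ω = (I-Λ)ᵀΣ(I-Λ), each ω is a polynomial of degree at most 3 in λ and
σ (`exists_identifying_omega`), and 3 ≤ 2s+1. For a node v, the half-trek criterion gives one linear
equation in the λ_{pv} for each y ∈ Y_v: its coefficients come from row y of (I-Λ)ᵀΣ if y ∈ htr(v),
and of Σ otherwise. Entries have degree at most 2, so Cramer's rule gives degree at most 2s+1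
(`SatisfiesHTC.exists_identifying_lambda`); the λ involved point into earlier nodes.

The determinant must not vanish. Among the half-trek systems obtained by exchanging tails, take one
of minimal total length. Put λ = 1 on its directed edges, λ = 0 on the others, and let ω be powers
X^ρ on its initial edges. By minimality the relation `Dominates` is acyclic, so ρ can be chosen such
that the matrix becomes diag(X^ρ)(1 + X E) (`IsHalfTrekSystem.det_htcMatrix_ne_zero`).

The algorithm. Let q be minimal among the remaining parameters for the identifying order. Its
homogenized identifying polynomial is q A - A' with A, A' free of remaining parameters. Reducing A
modulo the ideal shows that some minimal leading monomial is linear in q and free of the other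
remaining parameters (`exists_minimal_leadingExponent`). By homogeneity and elimination, the reduced
Gröbner basis element with this leading monomial is itself a homogenized identifying polynomial
(`exists_linear_form`), of weighted degree at most d·w_trek. So no pass gets stuck
(`Choices.search_ne_none`). -/

/-! ## Existence of reduced Gröbner bases -/

section Groebner

variable {ι : Type u} (m : MonomialOrder.{u, u} ι) (I : Ideal (MvPolynomial ι ℝ))

/-- The exponents of the leading monomials of the nonzero elements of `I`. -/
def leadingExponents : Set (ι →₀ ℕ) := {e | ∃ f ∈ I, f ≠ 0 ∧ m.degree f = e}

variable {m I}

theorem degree_mem_leadingExponents {f : MvPolynomial ι ℝ} (hf : f ∈ I) (h0 : f ≠ 0) :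
    m.degree f ∈ leadingExponents m I := ⟨f, hf, h0, rfl⟩

theorem leadingExponents_of_le {e e' : ι →₀ ℕ} (he : e ∈ leadingExponents m I) (h : e ≤ e') :
    e' ∈ leadingExponents m I := by
  classical
  obtain ⟨f, hf, h0, rfl⟩ := he
  have h1 : (monomial (e' - m.degree f) (1 : ℝ)) ≠ 0 := by simp
  refine ⟨monomial (e' - m.degree f) 1 * f, I.mul_mem_left _ hf, mul_ne_zero h1 h0, ?_⟩
  rw [m.degree_mul h1 h0, m.degree_monomial, if_neg one_ne_zero, tsub_add_cancel_of_le h]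

/-- Every monomial is congruent modulo `I` to a polynomial without monomials in the leading ideal. -/
theorem exists_normalForm (m : MonomialOrder.{u, u} ι) (I : Ideal (MvPolynomial ι ℝ))
    (p : MvPolynomial ι ℝ) :
    ∃ r, p - r ∈ I ∧ ∀ c ∈ r.support, c ∉ leadingExponents m I := by
  -- Division by all nonzero elements of the ideal at once: over a field every leading coefficient
  -- is a unit.
  obtain ⟨g, r, h1, -, h3⟩ := m.div_set (B := {f | f ∈ I ∧ f ≠ 0})
    (fun b hb => (m.leadingCoeff_ne_zero_iff.2 hb.2).isUnit) p
  refine ⟨r, ?_, ?_⟩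
  · rw [h1, add_sub_cancel_right, Finsupp.linearCombination_apply]
    exact I.sum_mem fun b _ => I.mul_mem_left _ b.2.1
  · rintro _ hc ⟨f, hf, h0, rfl⟩
    exact h3 _ hc f ⟨hf, h0⟩ le_rfl

theorem eq_zero_of_mem_of_notMem_leadingExponents {f : MvPolynomial ι ℝ} (hf : f ∈ I)
    (h : ∀ c ∈ f.support, c ∉ leadingExponents m I) : f = 0 := by
  by_contra h0
  exact h _ (m.degree_mem_support h0) (degree_mem_leadingExponents hf h0)

/-- The exponents of `r` avoid the leading ideal, so `e` is the only one that can lead. -/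
theorem degree_eq_of_sub_mem {e : ι →₀ ℕ} {r : MvPolynomial ι ℝ}
    (he : e ∈ leadingExponents m I) (hr : monomial e 1 - r ∈ I)
    (hr' : ∀ c ∈ r.support, c ∉ leadingExponents m I) :
    m.degree (monomial e 1 - r) = e ∧ m.leadingCoeff (monomial e 1 - r) = 1 := by
  classical
  have hc : coeff e (monomial e 1 - r) = 1 := by
    have : coeff e r = 0 := by
      by_contra h
      exact hr' e (mem_support_iff.2 h) he
    simp [this]
  have h0 : monomial e 1 - r ≠ 0 := by
    intro h
    simp [h] at hc
  have hd : m.degree (monomial e 1 - r) = e := by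
    by_contra hne
    have h1 := m.degree_mem_support h0
    rw [mem_support_iff, coeff_sub, coeff_monomial, if_neg (Ne.symm hne), zero_sub,
      neg_ne_zero] at h1
    exact hr' _ (mem_support_iff.2 h1) (degree_mem_leadingExponents hr h0)
  exact ⟨hd, by rw [MonomialOrder.leadingCoeff, hd, hc]⟩

/-- The reduced Gröbner basis of an ideal in finitely many variables exists, and its elements
are the minimal leading monomials minus their normal forms. -/
theorem exists_isReducedGroebnerBasis [Finite ι] (m : MonomialOrder.{u, u} ι)
    (I : Ideal (MvPolynomial ι ℝ)) :
    ∃ F, IsReducedGroebnerBasis m I F ∧ ∀ e, Minimal (· ∈ leadingExponents m I) e →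
      ∃ r, monomial e 1 - r ∈ F ∧ ∀ c ∈ r.support, c ∉ leadingExponents m I := by
  classical
  choose r hr hr' using fun e : ι →₀ ℕ => exists_normalForm m I (monomial e (1 : ℝ))
  set M : Set (ι →₀ ℕ) := {e | Minimal (· ∈ leadingExponents m I) e} with hM
  -- Dickson's lemma: the minimal exponents form an antichain in a well-quasi-order.
  have hfin : M.Finite :=
    (setOfPred_minimal_antichain (· ∈ leadingExponents m I)).finite_of_partiallyWellOrderedOn
      (Set.isPWO_of_wellQuasiOrderedLE M)
  have key : ∀ e ∈ M, m.degree (monomial e 1 - r e) = e ∧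
      m.leadingCoeff (monomial e 1 - r e) = 1 := fun e he =>
    degree_eq_of_sub_mem he.prop (hr e) (hr' e)
  refine ⟨hfin.toFinset.image fun e => monomial e 1 - r e, ⟨?_, ?_, ?_⟩, fun e he =>
    ⟨r e, ?_, hr' e⟩⟩
  · simp only [Finset.mem_image, Set.Finite.mem_toFinset]
    rintro f ⟨e, -, rfl⟩
    exact hr e
  · apply le_antisymm
    · rw [Ideal.span_le]
      rintro _ ⟨f, hf, rfl⟩
      by_cases h0 : f = 0
      · simp [h0]
      obtain ⟨e, hle, he⟩ := exists_minimal_le_of_wellFoundedLT (· ∈ leadingExponents m I) _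
        (degree_mem_leadingExponents (m := m) hf h0)
      have h1 : m.leadingTerm (monomial e 1 - r e) = monomial e 1 := by
        rw [MonomialOrder.leadingTerm, (key e he).1, (key e he).2]
      have h2 : m.leadingTerm f =
          monomial (m.degree f - e) (m.leadingCoeff f) * m.leadingTerm (monomial e 1 - r e) := by
        rw [h1, monomial_mul, tsub_add_cancel_of_le hle, mul_one, MonomialOrder.leadingTerm]
      rw [h2]
      refine Ideal.mul_mem_left _ _ (Ideal.subset_span ⟨_, ?_, rfl⟩)
      simp only [Finset.coe_image, Set.Finite.coe_toFinset]
      exact ⟨e, he, rfl⟩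
    · refine Ideal.span_mono (Set.image_mono ?_)
      simp only [Finset.coe_image, Set.Finite.coe_toFinset]
      rintro _ ⟨e, -, rfl⟩
      exact hr e
  · simp only [Finset.mem_image, Set.Finite.mem_toFinset]
    rintro _ ⟨e, he, rfl⟩
    refine ⟨(key e he).2, ?_⟩
    rintro _ ⟨e', he', rfl⟩ hne c hc hle
    rw [(key e' he').1] at hle
    rw [mem_support_iff, coeff_sub, coeff_monomial] at hc
    split_ifs at hc with hec
    · subst hec
      exact hne (by rw [he.eq_of_le he'.prop hle])
    · rw [zero_sub, neg_ne_zero] at hc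
      exact hr' e c (mem_support_iff.2 hc) (leadingExponents_of_le he'.prop hle)
  · simp only [Finset.mem_image, Set.Finite.mem_toFinset]
    exact ⟨e, he, rfl⟩

end Groebner

/-! ## Elimination in weighted homogeneous ideals -/

section Elimination

variable {ι : Type u} {m : MonomialOrder.{u, u} ι} {I : Ideal (MvPolynomial ι ℝ)} {w : ι → ℕ}
  {B : Set ι} {q : ι}

theorem weight_mono {e e' : ι →₀ ℕ} (h : e ≤ e') : Finsupp.weight w e ≤ Finsupp.weight w e' := by
  rw [← tsub_add_cancel_of_le h, map_add]
  exact Nat.le_add_left _ _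

/-- The homogeneous component of `f` through its leading monomial keeps that monomial and adds none.
-/
theorem exists_homogeneous_of_mem_leadingExponents
    (hI : ∀ f ∈ I, ∀ n, weightedHomogeneousComponent w n f ∈ I) {e : ι →₀ ℕ}
    (he : e ∈ leadingExponents m I) :
    ∃ f ∈ I, f ≠ 0 ∧ m.degree f = e ∧ IsWeightedHomogeneous w f (Finsupp.weight w e) := by
  classical
  obtain ⟨f, hf, h0, rfl⟩ := he
  set n := Finsupp.weight w (m.degree f) with hn
  have hc : coeff (m.degree f) (weightedHomogeneousComponent w n f) = coeff (m.degree f) f := by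
    rw [coeff_weightedHomogeneousComponent, if_pos hn.symm]
  have hc0 : coeff (m.degree f) (weightedHomogeneousComponent w n f) ≠ 0 := by
    rw [hc]
    exact m.coeff_degree_ne_zero_iff.2 h0
  refine ⟨_, hI f hf n, ?_, ?_, weightedHomogeneousComponent_isWeightedHomogeneous _ _⟩
  · intro h
    simp [h] at hc0
  · apply m.toSyn.injective
    apply le_antisymm
    · refine m.degree_le_iff.2 fun c hc' => m.le_degree ?_
      rw [support_weightedHomogeneousComponent] at hc'
      exact (Finset.mem_filter.1 hc').1
    · exact m.le_degree (mem_support_iff.2 hc0)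

/-- A component of `r` in any other degree would lie in `I` and have no exponent in the leading
ideal, hence vanish. -/
theorem isWeightedHomogeneous_normalForm
    (hI : ∀ f ∈ I, ∀ n, weightedHomogeneousComponent w n f ∈ I) {e : ι →₀ ℕ}
    {r : MvPolynomial ι ℝ} (hr : monomial e 1 - r ∈ I)
    (hr' : ∀ c ∈ r.support, c ∉ leadingExponents m I) :
    IsWeightedHomogeneous w r (Finsupp.weight w e) := by
  classical
  intro c hc
  by_contra hne
  have h1 := hI _ hr (Finsupp.weight w c)
  rw [map_sub, weightedHomogeneousComponent_of_mem (n := Finsupp.weight w e)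
    ((mem_weightedHomogeneousSubmodule _ _ _ _).2 (isWeightedHomogeneous_monomial _ _ _ rfl)),
    if_neg hne, zero_sub, neg_mem_iff] at h1
  have h2 := eq_zero_of_mem_of_notMem_leadingExponents (m := m) h1 fun c' hc' => by
    rw [support_weightedHomogeneousComponent] at hc'
    exact hr' c' (Finset.mem_filter.1 hc').1
  have h3 : coeff c (weightedHomogeneousComponent w (Finsupp.weight w c) r) = 0 := by
    rw [h2, coeff_zero]
  rw [coeff_weightedHomogeneousComponent, if_pos rfl] at h3
  exact hc h3

/-- The elimination property. At equal weight the lexicographic comparison in `B` decides, and a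
variable of `B` above `q` occurring in `c` would make `c` larger than `e`. -/
theorem IsGradedLexElim.eq_zero_of_le (hm : IsGradedLexElim w B q m) {c e : ι →₀ ℕ}
    (hle : m.toSyn c ≤ m.toSyn e) (hw : Finsupp.weight w c = Finsupp.weight w e)
    (he : ∀ x ∈ B, x ≠ q → e x = 0) : (∀ x ∈ B, x ≠ q → c x = 0) ∧ (q ∈ B → c q ≤ e q) := by
  obtain ⟨r, m₂, -, hr, hm⟩ := hm
  rcases hle.eq_or_lt with h | h
  · rw [m.toSyn.injective h]
    exact ⟨he, fun _ => le_rfl⟩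
  rcases (hm c e).1 h with h | ⟨-, ⟨x, hx, hxy⟩ | ⟨h, -⟩⟩
  · exact absurd hw h.ne
  · have hxq : (x : ι) = q := by
      by_contra hne
      rw [he x x.2 hne] at hx
      exact absurd hx (Nat.not_lt_zero _)
    refine ⟨fun y hy hyq => ?_, fun _ => hxq ▸ hx.le⟩
    obtain ⟨hq, hqy⟩ := hr ⟨y, hy⟩ hyq
    have hx' : x = ⟨q, hq⟩ := Subtype.ext hxq
    rw [hxy ⟨y, hy⟩ (hx' ▸ hqy)]
    exact he y hy hyq
  · exact ⟨fun x hx hxq => (h x hx).trans (he x hx hxq), fun hq => (h q hq).le⟩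

/-- If `q A - A'` is a homogeneous element of `I`, where `A ∉ I` and `A'` do not involve the
variables in `B`, then some minimal leading monomial is linear in `q` and does not involve the
other variables in `B`. -/
theorem exists_minimal_leadingExponent
    (hI : ∀ f ∈ I, ∀ n, weightedHomogeneousComponent w n f ∈ I)
    (hm : IsGradedLexElim w B q m) (hq : q ∈ B) {n : ℕ} {A' : MvPolynomial ι ℝ}
    (hA'w : IsWeightedHomogeneous w A' (w q + n)) (hA'B : ∀ c ∈ A'.support, ∀ x ∈ B, c x = 0)
    (A : MvPolynomial ι ℝ) (hA : A ∉ I) (hAw : IsWeightedHomogeneous w A n)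
    (hAB : ∀ c ∈ A.support, ∀ x ∈ B, c x = 0) (h : X q * A - A' ∈ I) :
    ∃ e, Minimal (· ∈ leadingExponents m I) e ∧ e q = 1 ∧ (∀ x ∈ B, x ≠ q → e x = 0) ∧
      Finsupp.weight w e ≤ w q + n := by
  classical
  -- Reduction of `A` modulo `I`, by induction on its leading monomial.
  induction hs : m.toSyn (m.degree A) using WellFoundedLT.induction generalizing A with
  | _ s ih =>
  subst hs
  have hA0 : A ≠ 0 := fun h0 => hA (h0 ▸ I.zero_mem)
  have hdA : Finsupp.weight w (m.degree A) = n := hAw (m.coeff_degree_ne_zero_iff.2 hA0)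
  -- If the leading monomial of `A` is reducible, a homogeneous `f ∈ I` with the same leading
  -- exponent is also free of `B`, by elimination. Subtracting a multiple of it preserves every
  -- assumption on `A`.
  by_cases hL : m.degree A ∈ leadingExponents m I
  · obtain ⟨f, hf, hf0, hfd, hfw⟩ := exists_homogeneous_of_mem_leadingExponents hI hL
    rw [hdA] at hfw
    set k : ℝ := m.leadingCoeff A / m.leadingCoeff f with hk
    have hfB : ∀ c ∈ f.support, ∀ x ∈ B, c x = 0 := by
      intro c hc x hx
      have h1 := hm.eq_zero_of_le (m.le_degree hc) (e := m.degree f)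
        ((hfw (mem_support_iff.1 hc)).trans (by rw [hfd, hdA]))
        (fun x hx _ => by rw [hfd]; exact hAB _ (m.degree_mem_support hA0) x hx)
      by_cases hxq : x = q
      · subst hxq
        have := h1.2 hx
        rw [hfd, hAB _ (m.degree_mem_support hA0) x hx] at this
        exact Nat.le_zero.1 this
      · exact h1.1 x hx hxq
    have hsub : A - C k * f ∉ I := fun h1 => hA (by
      have := I.add_mem h1 (I.mul_mem_left (C k) hf)
      rwa [sub_add_cancel] at this)
    have hsub0 : A - C k * f ≠ 0 := fun h0 => hsub (h0 ▸ I.zero_mem)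
    have hsupp : ∀ c ∈ (A - C k * f).support, c ∈ A.support ∨ c ∈ f.support := by
      intro c hc
      by_contra! hcc
      rw [mem_support_iff, coeff_sub, coeff_C_mul, notMem_support_iff.1 hcc.1,
        notMem_support_iff.1 hcc.2] at hc
      simp at hc
    refine ih _ ?_ (A - C k * f) hsub (hAw.sub (hfw.C_mul k)) ?_ ?_ rfl
    · apply lt_of_le_of_ne
      · refine m.degree_le_iff.2 fun c hc => ?_
        rcases hsupp c hc with hc | hc
        · exact m.le_degree hc
        · exact hfd ▸ m.le_degree hc
      · intro heq
        have h1 := m.coeff_degree_ne_zero_iff.2 hsub0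
        rw [m.toSyn.injective heq, coeff_sub, coeff_C_mul, hk, ← hfd] at h1
        apply h1
        have : m.leadingCoeff f ≠ 0 := m.leadingCoeff_ne_zero_iff.2 hf0
        change _ - _ * m.leadingCoeff f = 0
        rw [div_mul_cancel₀ _ this, hfd, sub_eq_zero]
        rfl
    · intro c hc
      rcases hsupp c hc with hc | hc
      · exact hAB c hc
      · exact hfB c hc
    · have : X q * (A - C k * f) - A' = X q * A - A' - (X q * C k) * f := by ring
      rw [this]
      exact I.sub_mem h (I.mul_mem_left _ hf)
  · set g := X q * A - A' with hg
    have hgw : IsWeightedHomogeneous w g (w q + n) :=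
      ((isWeightedHomogeneous_X ℝ w q).mul hAw).sub hA'w
    have hc1 : ∀ c, coeff (Finsupp.single q 1 + c) g = coeff c A := by
      intro c
      have : coeff (Finsupp.single q 1 + c) A' = 0 := by
        by_contra h1
        have := hA'B _ (mem_support_iff.2 h1) q hq
        simp at this
      rw [hg, coeff_sub, coeff_X_mul, this, sub_zero]
    have hg0 : g ≠ 0 := by
      intro h0
      have := hc1 (m.degree A)
      rw [h0, coeff_zero] at this
      exact m.coeff_degree_ne_zero_iff.2 hA0 this.symm
    have hmem : Finsupp.single q 1 + m.degree A ∈ g.support := by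
      rw [mem_support_iff, hc1]
      exact m.coeff_degree_ne_zero_iff.2 hA0
    have hE : ∀ c ∈ g.support, (∃ c' ∈ A.support, c = Finsupp.single q 1 + c') ∨
        ∀ x ∈ B, c x = 0 := by
      intro c hc
      by_cases h1 : c ∈ A'.support
      · exact Or.inr (hA'B c h1)
      · left
        rw [mem_support_iff, hg, coeff_sub, notMem_support_iff.1 h1, sub_zero] at hc
        have h2 : c ∈ (X q * A).support := mem_support_iff.2 hc
        rw [support_X_mul] at h2
        obtain ⟨c', hc', rfl⟩ := Finset.mem_map.1 h2
        exact ⟨c', hc', rfl⟩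
    -- At equal weight, monomials without variables of `B` are smaller than those containing `q`, so
    -- `A'` does not contribute the leading term.
    have hdeg : m.degree g = Finsupp.single q 1 + m.degree A := by
      have hle := m.le_degree hmem
      rcases hE _ (m.degree_mem_support hg0) with ⟨c', hc', h1⟩ | h1
      · have h2 := m.le_degree hc'
        rw [h1, map_add, map_add, add_le_add_iff_left] at hle
        rw [h1, m.toSyn.injective (le_antisymm h2 hle)]
      · have h2 := (hm.eq_zero_of_le hle ?_ fun x hx _ => h1 x hx).2 hq
        · rw [h1 q hq] at h2
          simp at h2
        · rw [hgw (mem_support_iff.1 hmem),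
            hgw (mem_support_iff.1 (m.degree_mem_support hg0))]
    obtain ⟨e, hle, he⟩ := exists_minimal_le_of_wellFoundedLT (· ∈ leadingExponents m I) _
      (degree_mem_leadingExponents (m := m) h hg0)
    have hAd := hAB _ (m.degree_mem_support hA0)
    refine ⟨e, he, ?_, ?_, ?_⟩
    · have h1 := hle q
      rw [hdeg, Finsupp.add_apply, Finsupp.single_eq_same, hAd q hq] at h1
      rcases Nat.lt_or_ge (e q) 1 with h2 | h2
      -- A minimal exponent below `q · deg A` without `q` would divide `deg A`, which is now
      -- irreducible.
      · exfalso
        refine hL (leadingExponents_of_le he.prop fun x => ?_)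
        by_cases hx : x = q
        · subst hx
          omega
        · have := hle x
          rwa [hdeg, Finsupp.add_apply, Finsupp.single_eq_of_ne hx, zero_add] at this
      · exact le_antisymm h1 h2
    · intro x hx hxq
      have := hle x
      rw [hdeg, Finsupp.add_apply, Finsupp.single_eq_of_ne hxq, hAd x hx] at this
      exact Nat.le_zero.1 this
    · refine (weight_mono hle).trans_eq ?_
      exact hgw (m.coeff_degree_ne_zero_iff.2 hg0)

/-- An element of the reduced Gröbner basis whose leading monomial is linear in `q` and does
not involve the other variables in `B` has the form `q a - b`, where `a ∉ I` and `b` do not involve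
variables in `B`. -/
theorem exists_linear_form
    (hI : ∀ f ∈ I, ∀ n, weightedHomogeneousComponent w n f ∈ I)
    (hm : IsGradedLexElim w B q m) (hq : q ∈ B) {e : ι →₀ ℕ}
    (he : Minimal (· ∈ leadingExponents m I) e) (heq : e q = 1) (heB : ∀ x ∈ B, x ≠ q → e x = 0)
    {r : MvPolynomial ι ℝ} (hr : monomial e 1 - r ∈ I)
    (hr' : ∀ c ∈ r.support, c ∉ leadingExponents m I) :
    weightedTotalDegree w (monomial e 1 - r) ≤ Finsupp.weight w e ∧
    ∃ a b, monomial e 1 - r = X q * a - b ∧ a ∉ I ∧ (∀ c ∈ a.support, ∀ x ∈ B, c x = 0) ∧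
      ∀ c ∈ b.support, ∀ x ∈ B, c x = 0 := by
  classical
  set f := monomial e 1 - r with hf
  have hfw : IsWeightedHomogeneous w f (Finsupp.weight w e) :=
    (isWeightedHomogeneous_monomial _ _ _ rfl).sub (isWeightedHomogeneous_normalForm hI hr hr')
  have hfd : m.degree f = e := (degree_eq_of_sub_mem he.prop hr hr').1
  have hfB : ∀ c ∈ f.support, (∀ x ∈ B, x ≠ q → c x = 0) ∧ c q ≤ 1 := by
    intro c hc
    have h1 := hm.eq_zero_of_le ((m.le_degree hc).trans_eq (by rw [hfd]))
      (hfw (mem_support_iff.1 hc)) heB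
    exact ⟨h1.1, heq ▸ h1.2 hq⟩
  refine ⟨Finset.sup_le fun c hc => (hfw (mem_support_iff.1 hc)).le,
    f.divMonomial (Finsupp.single q 1), -f.modMonomial (Finsupp.single q 1), ?_, ?_, ?_, ?_⟩
  · rw [sub_neg_eq_add]
    exact (divMonomial_add_modMonomial_single f q).symm
  -- If `a ∈ I`, then `q · deg a` is an exponent of `f`. If it equals `e`, the proper divisor `deg
  -- a` contradicts minimality; otherwise it is an exponent of `r` inside the leading ideal.
  · set a := f.divMonomial (Finsupp.single q 1) with ha
    intro haI
    have ha0 : a ≠ 0 := by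
      intro h0
      have h1 : coeff (e - Finsupp.single q 1) a = coeff e f := by
        rw [ha, coeff_divMonomial, add_tsub_cancel_of_le]
        intro x
        by_cases hx : x = q
        · subst hx
          simp [heq]
        · simp [Finsupp.single_eq_of_ne hx]
      rw [h0, coeff_zero, ← hfd] at h1
      refine m.coeff_degree_ne_zero_iff.2 ?_ h1.symm
      intro hf0
      have h2 := hfd
      rw [hf0, m.degree_zero] at h2
      simp [← h2] at heq
    have hd := degree_mem_leadingExponents (m := m) haI ha0
    have h2 : coeff (Finsupp.single q 1 + m.degree a) f ≠ 0 := by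
      rw [← coeff_divMonomial]
      exact m.coeff_degree_ne_zero_iff.2 ha0
    by_cases h3 : Finsupp.single q 1 + m.degree a = e
    · have h4 : m.degree a ≤ e := h3 ▸ le_add_self
      have h5 := he.eq_of_le hd h4
      rw [← h5] at h3
      simp at h3
    · rw [hf, coeff_sub, coeff_monomial, if_neg (Ne.symm h3), zero_sub, neg_ne_zero] at h2
      exact hr' _ (mem_support_iff.2 h2) (leadingExponents_of_le hd le_add_self)
  · intro c hc x hx
    rw [mem_support_iff, coeff_divMonomial] at hc
    have h1 := hfB _ (mem_support_iff.2 hc)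
    by_cases hxq : x = q
    · subst hxq
      have h2 := h1.2
      rw [Finsupp.add_apply, Finsupp.single_eq_same] at h2
      omega
    · have h2 := h1.1 x hx hxq
      rw [Finsupp.add_apply] at h2
      omega
  · intro c hc x hx
    rw [mem_support_iff, coeff_neg, neg_ne_zero] at hc
    by_cases hle : Finsupp.single q 1 ≤ c
    · exact absurd (coeff_modMonomial_of_le f hle) hc
    · have h1 : c q = 0 := by
        by_contra h0
        exact hle (by simpa [Finsupp.single_le_iff] using Nat.one_le_iff_ne_zero.2 h0)
      rw [coeff_modMonomial_of_not_le f hle] at hc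
      by_cases hxq : x = q
      · rwa [hxq]
      · exact (hfB c (mem_support_iff.2 hc)).1 x hx hxq

end Elimination

/-! ## Homogenization and the algorithm -/

theorem mem_supported_iff_support {ι : Type*} {s : Set ι} {p : MvPolynomial ι ℝ} :
    p ∈ supported ℝ s ↔ ∀ c ∈ p.support, ∀ x ∉ s, c x = 0 := by
  rw [mem_supported]
  constructor
  · intro h c hc x hx
    by_contra h0
    exact hx (h ((mem_vars_iff_mem_support x).2 ⟨c, hc, Finsupp.mem_support_iff.2 h0⟩))
  · intro h x hx
    obtain ⟨c, hc, hxc⟩ := (mem_vars_iff_mem_support x).1 hx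
    by_contra hxs
    exact Finsupp.mem_support_iff.1 hxc (h c hc x hxs)

namespace MixedGraph

variable {V : Type u} (G : MixedGraph V)

/-- The homogenization of polynomials of weighted degree at most `D` to the weighted degree `D`,
as a linear map. -/
noncomputable def homogenizeTo (D : ℕ) : MvPolynomial G.Var ℝ →ₗ[ℝ] MvPolynomial G.HVar ℝ :=
  (basisMonomials G.Var ℝ).constr ℝ fun m =>
    monomial (m.mapDomain some + Finsupp.single none (D - Finsupp.weight G.trekWeight m)) 1

theorem homogenizeTo_apply (D : ℕ) (f : MvPolynomial G.Var ℝ) :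
    G.homogenizeTo D f = ∑ m ∈ f.support, monomial
      (m.mapDomain some + Finsupp.single none (D - Finsupp.weight G.trekWeight m)) (coeff m f) := by
  rw [homogenizeTo, Module.Basis.constr_apply]
  refine Finset.sum_congr rfl fun m _ => ?_
  exact (smul_monomial _).trans (by rw [smul_eq_mul, mul_one]; rfl)

theorem homogenizeTo_monomial (D : ℕ) (m : G.Var →₀ ℕ) (c : ℝ) :
    G.homogenizeTo D (monomial m c) = monomial
      (m.mapDomain some + Finsupp.single none (D - Finsupp.weight G.trekWeight m)) c := by
  have h : monomial m c = c • basisMonomials G.Var ℝ m := by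
    rw [coe_basisMonomials, smul_monomial, smul_eq_mul, mul_one]
  rw [h, map_smul, homogenizeTo, Module.Basis.constr_basis, smul_monomial, smul_eq_mul, mul_one]

theorem homogenize_eq (f : MvPolynomial G.Var ℝ) :
    G.homogenize f = G.homogenizeTo (weightedTotalDegree G.trekWeight f) f := by
  rw [homogenizeTo_apply, homogenize]

/-- No degree bound on `a` is needed: parameters have weight 1, so the truncated difference giving
the power of `h` is the same on both sides. -/
theorem homogenizeTo_X_mul (n : ℕ) (q : G.Param) (a : MvPolynomial G.Var ℝ) :
    G.homogenizeTo (1 + n) (X (Sum.inl q) * a) =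
      X (some (Sum.inl q)) * G.homogenizeTo n a := by
  induction a using induction_on' with
  | add p q hp hq => rw [mul_add, map_add, map_add, mul_add, hp, hq]
  | monomial m c =>
    have hw : G.trekWeight (Sum.inl q) = 1 := rfl
    rw [homogenizeTo_monomial, X, X, monomial_mul, monomial_mul, homogenizeTo_monomial, one_mul,
      map_add, Finsupp.weight_single, hw, one_smul, Nat.add_sub_add_left, Finsupp.mapDomain_add,
      Finsupp.mapDomain_single, add_assoc]

theorem exists_of_mem_support_homogenizeTo {D : ℕ} {f : MvPolynomial G.Var ℝ}
    {c : G.HVar →₀ ℕ} (hc : c ∈ (G.homogenizeTo D f).support) :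
    ∃ m ∈ f.support,
      c = m.mapDomain some + Finsupp.single none (D - Finsupp.weight G.trekWeight m) := by
  rw [homogenizeTo_apply, mem_support_iff, coeff_sum] at hc
  obtain ⟨m, hm, hc⟩ := Finset.exists_ne_zero_of_sum_ne_zero hc
  exact ⟨m, hm, Finset.mem_singleton.1 (support_monomial_subset (mem_support_iff.2 hc))⟩

theorem weight_mapDomain_some (m : G.Var →₀ ℕ) :
    Finsupp.weight G.trekWeightH (m.mapDomain some) = Finsupp.weight G.trekWeight m := by
  rw [Finsupp.weight_apply, Finsupp.weight_apply, Finsupp.sum_mapDomain_index (by simp)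
    (by intros; rw [add_smul])]
  rfl

theorem isWeightedHomogeneous_homogenizeTo {D : ℕ} {f : MvPolynomial G.Var ℝ}
    (h : ∀ m ∈ f.support, Finsupp.weight G.trekWeight m ≤ D) :
    IsWeightedHomogeneous G.trekWeightH (G.homogenizeTo D f) D := by
  intro c hc
  obtain ⟨m, hm, rfl⟩ := G.exists_of_mem_support_homogenizeTo (mem_support_iff.2 hc)
  have hw : G.trekWeightH none = 1 := rfl
  rw [map_add, weight_mapDomain_some, Finsupp.weight_single, hw, smul_eq_mul, mul_one]
  have := h m hm
  omega

/-- Setting `h = 1`. -/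
noncomputable def dehomogenize : MvPolynomial G.HVar ℝ →ₐ[ℝ] MvPolynomial G.Var ℝ :=
  aeval fun x => x.elim 1 X

theorem dehomogenize_homogenizeTo (D : ℕ) (f : MvPolynomial G.Var ℝ) :
    G.dehomogenize (G.homogenizeTo D f) = f := by
  induction f using induction_on' with
  | add p q hp hq => rw [map_add, map_add, hp, hq]
  | monomial m c =>
    have h : monomial (m.mapDomain some +
        Finsupp.single none (D - Finsupp.weight G.trekWeight m)) c =
        rename some (monomial m c) *
          (X none : MvPolynomial G.HVar ℝ) ^ (D - Finsupp.weight G.trekWeight m) := by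
      rw [rename_monomial, X_pow_eq_monomial, monomial_mul, mul_one]
    rw [homogenizeTo_monomial, h, map_mul, map_pow, dehomogenize, aeval_X, Option.elim_none,
      one_pow, mul_one, aeval_rename]
    exact aeval_X_left_apply _

variable [Fintype V] [DecidableEq V]

/-- Used in contrapositive form: `a ∉ I` passes to the homogenization of `a`. -/
theorem dehomogenize_mem {f : MvPolynomial G.HVar ℝ} (hf : f ∈ G.homIdeal) :
    G.dehomogenize f ∈ G.graphIdeal := by
  have h : G.homIdeal ≤ G.graphIdeal.comap G.dehomogenize := by
    rw [homIdeal, Ideal.span_le]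
    rintro _ ⟨g, hg, rfl⟩
    rw [SetLike.mem_coe, Ideal.mem_comap, homogenize_eq, dehomogenize_homogenizeTo]
    exact hg
  exact h hf

theorem weightedHomogeneousComponent_mem_homIdeal {f : MvPolynomial G.HVar ℝ}
    (hf : f ∈ G.homIdeal) (n : ℕ) :
    weightedHomogeneousComponent G.trekWeightH n f ∈ G.homIdeal := by
  let _ := weightedGradedAlgebra ℝ G.trekWeightH
  refine weightedHomogeneousComponent_mem_of_mem ℝ G.trekWeightH
    (Ideal.homogeneous_span _ _ ?_) hf n
  rintro _ ⟨g, -, rfl⟩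
  refine ⟨weightedTotalDegree G.trekWeight g, ?_⟩
  rw [homogenize_eq]
  exact G.isWeightedHomogeneous_homogenizeTo fun m hm => le_weightedTotalDegree _ hm

omit [DecidableEq V] in
theorem bddAbove_iUnion_trekLengths : BddAbove (⋃ e, G.trekLengths e) := by
  classical
  refine (Set.finite_univ (α := Sym2 V)).bddAbove_biUnion (S := G.trekLengths) |>.2
    (fun e _ => G.trekLengths_bddAbove e) |>.mono ?_
  simp

omit [DecidableEq V] in
theorem one_le_maxTrekLength (v : V) : 1 ≤ G.maxTrekLength := by
  refine le_csSup G.bddAbove_iUnion_trekLengths (Set.mem_iUnion.2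
    ⟨s(v, v), [v], [v], v, v, rfl, ?_, rfl⟩)
  simp [IsTrek]

omit [DecidableEq V] in
theorem trekWeight_le_maxTrekLength [Nonempty V] (x : G.Var) :
    G.trekWeight x ≤ G.maxTrekLength := by
  have h1 := G.one_le_maxTrekLength (Classical.arbitrary V)
  rcases x with q | e
  · exact h1
  · simp only [trekWeight]
    split_ifs with h
    · exact csSup_le_csSup G.bddAbove_iUnion_trekLengths h (Set.subset_iUnion _ e)
    · exact h1

-- The origin of the bound `d * w_trek` in the outer loop: each variable weighs at most the maximal
-- trek length.
omit [DecidableEq V] in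
theorem weightedTotalDegree_le [Nonempty V] (f : MvPolynomial G.Var ℝ) :
    weightedTotalDegree G.trekWeight f ≤ f.totalDegree * G.maxTrekLength := by
  refine Finset.sup_le fun c hc => ?_
  calc Finsupp.weight G.trekWeight c ≤ c.sum fun _ k => k * G.maxTrekLength := by
        rw [Finsupp.weight_apply]
        exact Finset.sum_le_sum fun x _ =>
          Nat.mul_le_mul_left _ (G.trekWeight_le_maxTrekLength x)
    _ = (c.sum fun _ k => k) * G.maxTrekLength := by
        rw [Finsupp.sum, Finsupp.sum, Finset.sum_mul]
    _ ≤ _ := Nat.mul_le_mul_right _ (le_totalDegree hc)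

variable {G}

omit [Fintype V] [DecidableEq V] in
theorem mem_supported_compl_image {S : Set G.Param} {f : MvPolynomial G.HVar ℝ}
    (h : ∀ c ∈ f.support, ∀ x ∈ (some ∘ Sum.inl) '' Sᶜ, c x = 0) :
    f ∈ supported ℝ ((some ∘ Sum.inl) '' Sᶜ : Set G.HVar)ᶜ :=
  mem_supported_iff_support.2 fun c hc x hx => h c hc x (not_not.1 hx)

omit [Fintype V] [DecidableEq V] in
theorem homogenizeTo_support_eq_zero {S T : Set G.Param} (hT : T ⊆ S) {D : ℕ}
    {a : MvPolynomial G.Var ℝ}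
    (ha : a ∈ supported ℝ (Sum.inl '' T ∪ Set.range Sum.inr : Set G.Var)) :
    ∀ c ∈ (G.homogenizeTo D a).support, ∀ x ∈ (some ∘ Sum.inl) '' Sᶜ, c x = 0 := by
  rintro c hc _ ⟨p, hp, rfl⟩
  obtain ⟨m, hm, rfl⟩ := G.exists_of_mem_support_homogenizeTo hc
  have h1 : m (Sum.inl p) = 0 := by
    refine mem_supported_iff_support.1 ha m hm _ ?_
    rintro (⟨t, ht, h⟩ | ⟨t, h⟩)
    · exact hp (Sum.inl_injective h ▸ hT ht)
    · cases h
  rw [Finsupp.add_apply, Function.comp_apply, Finsupp.mapDomain_apply (Option.some_injective _),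
    h1, Finsupp.single_eq_of_ne (by simp), add_zero]

/-- The polynomials whose parameters have been identified give a homogenized identifying polynomial
in the reduced Gröbner basis. -/
theorem exists_mem_groebnerUpTo {r : G.Param → G.Param → Prop} [Std.Irrefl r] {q : G.Param}
    {g : MvPolynomial G.Var ℝ} (hg : G.IsIdentifyingPolynomial r q g) {S : Set G.Param}
    (hq : q ∉ S) (hS : ∀ p, r p q → p ∈ S) {m : MonomialOrder.{u, u} G.HVar}
    (hm : IsGradedLexElim G.trekWeightH ((some ∘ Sum.inl) '' Sᶜ) (some (Sum.inl q)) m) {k : ℕ}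
    (hk : weightedTotalDegree G.trekWeight g ≤ k) :
    ∃ f ∈ groebnerUpTo G.trekWeightH m G.homIdeal k, G.IsHomIdentifyingPolynomial S q f := by
  classical
  obtain ⟨hgI, T, hT, a, ha, b, hb, hgab, haI⟩ := hg
  have hTS : T ⊆ S := fun p hp => hS p (hT p hp)
  have hqT : Sum.inl q ∉ (Sum.inl '' T ∪ Set.range Sum.inr : Set G.Var) := by
    rintro (⟨t, ht, h⟩ | ⟨t, h⟩)
    · exact hq (hTS (Sum.inl_injective h ▸ ht))
    · cases h
  -- Since `b` is free of `q`, nothing cancels between `q a` and `b`; the weighted degree of `g`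
  -- therefore bounds those of both.
  have haq : ∀ c ∈ a.support, Finsupp.single (Sum.inl q) 1 + c ∈ g.support := by
    intro c hc
    have : coeff (Finsupp.single (Sum.inl q) 1 + c) b = 0 := by
      by_contra h1
      have := mem_supported_iff_support.1 hb _ (mem_support_iff.2 h1) _ hqT
      simp at this
    rw [mem_support_iff, hgab, coeff_sub, coeff_X_mul, this, sub_zero]
    exact mem_support_iff.1 hc
  have hbq : ∀ c ∈ b.support, c ∈ g.support := by
    intro c hc
    have h1 : coeff c (X (Sum.inl q) * a) = 0 := by
      rw [coeff_X_mul', if_neg]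
      simpa using mem_supported_iff_support.1 hb c hc _ hqT
    rw [mem_support_iff, hgab, coeff_sub, h1, zero_sub, neg_ne_zero]
    exact mem_support_iff.1 hc
  set D := weightedTotalDegree G.trekWeight g with hD
  have hwq : G.trekWeight (Sum.inl q) = 1 := rfl
  have hwa : ∀ c ∈ a.support, 1 + Finsupp.weight G.trekWeight c ≤ D := by
    intro c hc
    have := le_weightedTotalDegree G.trekWeight (haq c hc)
    rwa [map_add, Finsupp.weight_single, hwq, one_smul] at this
  have hwb : ∀ c ∈ b.support, Finsupp.weight G.trekWeight c ≤ D := fun c hc =>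
    le_weightedTotalDegree G.trekWeight (hbq c hc)
  have ha0 : a ≠ 0 := fun h => haI (h ▸ Ideal.zero_mem _)
  obtain ⟨n, hn⟩ : ∃ n, D = 1 + n := by
    obtain ⟨c, hc⟩ := support_nonempty.2 ha0
    exact Nat.exists_eq_add_of_le ((Nat.le_add_right 1 _).trans (hwa c hc))
  have hmem : X (some (Sum.inl q)) * G.homogenizeTo n a - G.homogenizeTo (1 + n) b ∈
      G.homIdeal := by
    rw [← homogenizeTo_X_mul, ← map_sub, ← hgab, ← hn, hD, ← homogenize_eq]
    exact Ideal.subset_span ⟨g, hgI, rfl⟩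
  have hI : ∀ f ∈ G.homIdeal, ∀ n, weightedHomogeneousComponent G.trekWeightH n f ∈ G.homIdeal :=
    fun f hf n => G.weightedHomogeneousComponent_mem_homIdeal hf n
  have hqB : some (Sum.inl q) ∈ ((some ∘ Sum.inl) '' Sᶜ : Set G.HVar) := ⟨q, hq, rfl⟩
  obtain ⟨e, he, heq, heB, hew⟩ := exists_minimal_leadingExponent hI hm hqB (n := n)
    (G.isWeightedHomogeneous_homogenizeTo (D := 1 + n) fun c hc => hn ▸ hwb c hc)
    (homogenizeTo_support_eq_zero hTS hb) (G.homogenizeTo n a)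
    (fun h => haI (by simpa only [dehomogenize_homogenizeTo] using G.dehomogenize_mem h))
    (G.isWeightedHomogeneous_homogenizeTo fun c hc => by have := hwa c hc; omega)
    (homogenizeTo_support_eq_zero hTS ha) hmem
  obtain ⟨F, hF, hFe⟩ := exists_isReducedGroebnerBasis m G.homIdeal
  obtain ⟨p, hpF, hp⟩ := hFe e he
  obtain ⟨hdeg, a', b', hab', ha'I, ha', hb'⟩ :=
    exists_linear_form hI hm hqB he heq heB (hF.1 _ hpF) hp
  refine ⟨_, ⟨F, hF, hpF, hdeg.trans (hew.trans ?_)⟩, hF.1 _ hpF, a',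
    mem_supported_compl_image ha', b', mem_supported_compl_image hb', hab', ha'I⟩
  exact hn.symm.trans_le hk

/-- The identified set `S` need not be an initial segment of `r`, as the algorithm may pick
parameters in another sequence. A minimal `q` outside `S` still has all its predecessors in `S`, and
it succeeds at the last `k` if nothing was found before. -/
theorem Choices.search_ne_none (C : G.Choices) {r : G.Param → G.Param → Prop}
    {P : G.Param → MvPolynomial G.Var ℝ} (hP : G.IsIdentifyingOrderWith r P) {d : ℕ} (hd : 1 ≤ d)
    (hdeg : ∀ q, (P q).totalDegree ≤ d) {S : Set G.Param} (hS : S ≠ Set.univ) :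
    C.search d S ≠ none := by
  classical
  have := hP.1
  have hwf : WellFounded r := Finite.wellFounded_of_trans_of_irrefl r
  obtain ⟨q, hq, hmin⟩ := hwf.has_min Sᶜ (Set.nonempty_compl.2 hS)
  have hV : Nonempty V := by
    rcases q with q | ⟨e, -⟩
    · exact ⟨q.1.1⟩
    · exact ⟨e.out.1⟩
  have hlen := G.one_le_maxTrekLength (Classical.arbitrary V)
  have h1 : 1 ≤ d * G.maxTrekLength := Nat.mul_pos hd hlen
  obtain ⟨f, hf, hf'⟩ := exists_mem_groebnerUpTo (hP.2 q) hq
    (fun p hp => not_not.1 fun h => hmin p h hp) (C.order_spec S (d * G.maxTrekLength) q hq)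
    ((G.weightedTotalDegree_le _).trans (Nat.mul_le_mul_right _ (hdeg q)))
  rw [Choices.search, Ne, List.findSome?_eq_none_iff]
  intro h
  have h2 := h (d * G.maxTrekLength) (by rw [List.mem_range'_1]; omega)
  rw [List.findSome?_eq_none_iff] at h2
  have h3 := h2 q ((C.mem_outer _ _ _).2 hq)
  rw [List.find?_eq_none] at h3
  exact h3 q ((C.mem_inner _ _ _ _).2 hq) (decide_eq_true ⟨f, hf, hf'⟩)

theorem Choices.notMem_of_search_eq_some (C : G.Choices) {d : ℕ} {S : Set G.Param} {q : G.Param}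
    (h : C.search d S = some q) : q ∉ S := by
  classical
  rw [Choices.search] at h
  obtain ⟨k, -, h⟩ := List.exists_of_findSome?_eq_some h
  obtain ⟨p, -, h⟩ := List.exists_of_findSome?_eq_some h
  exact (C.mem_inner _ _ _ _).1 (List.mem_of_find?_eq_some h)

/-- The algorithm succeeds if there are identifying polynomials of degree at most `d`. -/
theorem Choices.returnsYes (C : G.Choices) {r : G.Param → G.Param → Prop}
    {P : G.Param → MvPolynomial G.Var ℝ} (hP : G.IsIdentifyingOrderWith r P) {d : ℕ} (hd : 1 ≤ d)
    (hdeg : ∀ q, (P q).totalDegree ≤ d) : C.ReturnsYes d := by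
  have key : ∀ S : Set G.Param, C.run d S = Set.univ := by
    intro S
    induction hn : (Sᶜ).ncard using Nat.strong_induction_on generalizing S with
    | _ n ih =>
    rw [Choices.run]
    split_ifs with h
    · rcases h with h | h
      · exact h
      · by_contra hne
        rw [h] at hne
        obtain ⟨q, hq⟩ := Option.ne_none_iff_exists'.1 (C.search_ne_none hP hd hdeg hne)
        have h2 : C.pass d S = insert q S := by rw [Choices.pass, hq]
        exact C.notMem_of_search_eq_some hq (h ▸ h2 ▸ Set.mem_insert q S)
    · refine ih _ ?_ _ rfl
      rw [← hn]
      have h2 : C.pass d S ≠ S := fun e => h (Or.inr e)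
      exact Set.ncard_lt_ncard (compl_lt_compl_iff_lt.2
        ((C.subset_pass d S).ssubset_of_ne h2.symm)) (Set.toFinite _)
  exact key ∅

end MixedGraph

/-! ## The parametrization -/

namespace MixedGraph

variable {V : Type u} (G : MixedGraph V)

/-- Acyclicity makes every directed walk free of repetitions. -/
theorem exists_path_of_reflTransGen {a b : V} (h : Relation.ReflTransGen G.dir a b) :
    ∃ R : List V, R.IsChain G.dir ∧ R.Nodup ∧ R.getLast? = some b ∧ R.head? = some a := by
  obtain ⟨l, hl, hlast⟩ := List.exists_isChain_cons_of_relationReflTransGen h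
  refine ⟨a :: l, hl, ?_, by rw [List.getLast?_eq_getLast_of_ne_nil (by simp), hlast], rfl⟩
  have h1 : (a :: l).IsChain (Relation.TransGen G.dir) := hl.imp fun _ _ => .single
  exact (List.isChain_iff_pairwise.1 h1).imp fun hxy heq => by
    subst heq
    exact G.acyclic _ hxy

theorem mem_htr_of_reflTransGen {a v y : V} (h : Relation.ReflTransGen G.dir a y)
    (hav : v = a ∨ G.bi.Adj v a) (hy : y ≠ v) (hy' : ¬ G.bi.Adj v y) : y ∈ G.htr v := by
  obtain ⟨R, h1, h2, h3, h4⟩ := G.exists_path_of_reflTransGen h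
  exact ⟨hy, hy', R, by simp, h1, by simp, h2, rfl, h3, v, a, rfl, h4, hav⟩

variable [Fintype V] [DecidableEq V]

omit [DecidableEq V] in
theorem exists_rank : ∃ f : V → ℕ, ∀ u v, G.dir u v → f u < f v := by
  refine ⟨fun v => {a | Relation.TransGen G.dir a v}.ncard, fun u v huv => ?_⟩
  refine Set.ncard_lt_ncard ⟨fun a ha => Relation.TransGen.tail ha huv, fun h => ?_⟩
    (Set.toFinite _)
  exact G.acyclic u (h (Relation.TransGen.single huv))

omit [Fintype V] [DecidableEq V] in
theorem Lam_apply_of_not_dir {u v : V} (h : ¬ G.dir u v) : G.Lam u v = 0 := by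
  simp [Lam, h]

omit [Fintype V] [DecidableEq V] in
theorem Lam_apply_of_dir {u v : V} (h : G.dir u v) :
    G.Lam u v = X (Sum.inl ⟨(u, v), h⟩) := by
  simp [Lam, h]

/-- A nonzero entry of Λᵏ forces the rank to rise by `k`, and ranks are bounded. Hence I-Λ is
invertible over the polynomial ring itself. -/
theorem isNilpotent_Lam : IsNilpotent G.Lam := by
  obtain ⟨f, hf⟩ := G.exists_rank
  have key : ∀ k : ℕ, ∀ u v, (G.Lam ^ k) u v ≠ 0 → f u + k ≤ f v := by
    intro k
    induction k with
    | zero =>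
      intro u v h
      rw [pow_zero, Matrix.one_apply] at h
      split_ifs at h with huv
      · simp [huv]
      · exact absurd rfl h
    | succ k ih =>
      intro u v h
      rw [pow_succ, Matrix.mul_apply] at h
      obtain ⟨c, -, hc⟩ := Finset.exists_ne_zero_of_sum_ne_zero h
      have h1 := ih u c (left_ne_zero_of_mul hc)
      have h2 := hf c v (by
        by_contra hcv
        exact right_ne_zero_of_mul hc (G.Lam_apply_of_not_dir hcv))
      omega
  refine ⟨Finset.univ.sup f + 1, Matrix.ext fun u v => ?_⟩
  by_contra h
  have h1 := key _ u v h
  have h2 := Finset.le_sup (f := f) (Finset.mem_univ v)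
  omega

theorem isUnit_det_one_sub_Lam : IsUnit (1 - G.Lam).det :=
  (Matrix.isUnit_iff_isUnit_det _).1 G.isNilpotent_Lam.isUnit_one_sub

theorem inv_mul_one_sub_Lam : (1 - G.Lam)⁻¹ * (1 - G.Lam) = 1 :=
  Matrix.nonsing_inv_mul _ G.isUnit_det_one_sub_Lam

theorem one_sub_Lam_transpose_mul_inv :
    (1 - G.Lam).transpose * ((1 - G.Lam)⁻¹).transpose = 1 := by
  rw [← Matrix.transpose_mul, inv_mul_one_sub_Lam, Matrix.transpose_one]

/-- Induction on the rank of `b`, with N = 1 + NΛ for N = (I-Λ)⁻¹. -/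
theorem reflTransGen_of_inv_ne_zero {a b : V} (h : (1 - G.Lam)⁻¹ a b ≠ 0) :
    Relation.ReflTransGen G.dir a b := by
  obtain ⟨f, hf⟩ := G.exists_rank
  induction hn : f b using Nat.strong_induction_on generalizing b with
  | _ n ih =>
  have h1 := congrFun (congrFun G.inv_mul_one_sub_Lam a) b
  rw [Matrix.mul_sub, Matrix.mul_one, Matrix.sub_apply, sub_eq_iff_eq_add, Matrix.mul_apply] at h1
  rw [h1] at h
  by_cases hab : a = b
  · rw [hab]
  rw [Matrix.one_apply_ne hab, zero_add] at h
  obtain ⟨c, -, hc⟩ := Finset.exists_ne_zero_of_sum_ne_zero h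
  have hcb : G.dir c b := by
    by_contra hcb
    exact right_ne_zero_of_mul hc (G.Lam_apply_of_not_dir hcb)
  exact (ih _ (hn ▸ hf c b hcb) (left_ne_zero_of_mul hc) rfl).tail hcb

theorem one_sub_Lam_transpose_mul_covMatrix :
    (1 - G.Lam).transpose * G.covMatrix = G.Omega * (1 - G.Lam)⁻¹ := by
  rw [covMatrix, Matrix.mul_assoc, ← Matrix.mul_assoc, one_sub_Lam_transpose_mul_inv,
    Matrix.one_mul]

theorem covMatrix_mul_one_sub_Lam :
    G.covMatrix * (1 - G.Lam) = ((1 - G.Lam)⁻¹).transpose * G.Omega := by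
  rw [covMatrix, Matrix.mul_assoc, inv_mul_one_sub_Lam, Matrix.mul_one]

/-- The substitution of `τ_G(σ)` for `σ`. -/
noncomputable def substCov : MvPolynomial G.Var ℝ →ₐ[ℝ] MvPolynomial G.Param ℝ :=
  aeval (Sum.elim X G.tau)

/-- Modulo the ideal every `f` is congruent to its substituted form, so the ideal is the kernel of
the substitution. All membership questions become identities in ℝ[θ]. -/
theorem mem_graphIdeal_iff {f : MvPolynomial G.Var ℝ} : f ∈ G.graphIdeal ↔ G.substCov f = 0 := by
  constructor
  · intro hf
    have h : G.graphIdeal ≤ RingHom.ker G.substCov := by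
      rw [graphIdeal, Ideal.span_le]
      rintro _ ⟨e, rfl⟩
      rw [SetLike.mem_coe, RingHom.mem_ker, map_sub, substCov, aeval_X, aeval_rename,
        Sum.elim_inr, sub_eq_zero]
      exact (aeval_X_left_apply _).symm
    exact h hf
  · intro hf
    have h : Ideal.Quotient.mkₐ ℝ G.graphIdeal =
        (Ideal.Quotient.mkₐ ℝ G.graphIdeal).comp ((rename Sum.inl).comp G.substCov) := by
      refine algHom_ext fun x => ?_
      rcases x with q | e
      · simp [substCov]
      · simp only [AlgHom.comp_apply, substCov, aeval_X, Sum.elim_inr]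
        exact Ideal.Quotient.eq.2 (Ideal.subset_span ⟨e, rfl⟩)
    have h1 := DFunLike.congr_fun h f
    rw [AlgHom.comp_apply, AlgHom.comp_apply, hf, map_zero, map_zero] at h1
    exact Ideal.Quotient.eq_zero_iff_mem.1 h1

/-- The matrix `Λ` over `ℝ[θ, σ]`. -/
noncomputable def LamVar : Matrix V V (MvPolynomial G.Var ℝ) := G.Lam.map (rename Sum.inl)

/-- The matrix `Σ` of the indeterminates `σ`. -/
noncomputable def sigmaVar : Matrix V V (MvPolynomial G.Var ℝ) :=
  Matrix.of fun u v => X (Sum.inr s(u, v))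

omit [Fintype V] [DecidableEq V] in
theorem LamVar_apply_of_dir {u v : V} (h : G.dir u v) :
    G.LamVar u v = X (Sum.inl (Sum.inl ⟨(u, v), h⟩)) := by
  rw [LamVar, Matrix.map_apply, Lam_apply_of_dir _ h, rename_X]

omit [Fintype V] [DecidableEq V] in
theorem LamVar_apply_of_not_dir {u v : V} (h : ¬ G.dir u v) : G.LamVar u v = 0 := by
  rw [LamVar, Matrix.map_apply, Lam_apply_of_not_dir _ h, map_zero]

theorem map_sigmaVar : G.sigmaVar.map G.substCov = G.covMatrix := by
  ext1 u v
  simp [sigmaVar, substCov, tau]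

theorem map_LamVar : G.LamVar.map G.substCov = G.Lam := by
  ext1 u v
  rw [LamVar, Matrix.map_apply, Matrix.map_apply, substCov, aeval_rename]
  exact aeval_X_left_apply _

theorem map_one_sub_LamVar : (1 - G.LamVar).map G.substCov = 1 - G.Lam := by
  rw [Matrix.map_sub _ (map_sub _), Matrix.map_one _ (map_zero _) (map_one _), map_LamVar]

theorem map_transpose_mul_sigmaVar :
    ((1 - G.LamVar).transpose * G.sigmaVar).map G.substCov = G.Omega * (1 - G.Lam)⁻¹ := by
  rw [Matrix.map_mul, Matrix.transpose_map, map_one_sub_LamVar, map_sigmaVar,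
    one_sub_Lam_transpose_mul_covMatrix]

theorem map_transpose_mul_sigmaVar_mul :
    ((1 - G.LamVar).transpose * G.sigmaVar * (1 - G.LamVar)).map G.substCov = G.Omega := by
  rw [Matrix.map_mul, map_transpose_mul_sigmaVar, map_one_sub_LamVar, Matrix.mul_assoc,
    inv_mul_one_sub_Lam, Matrix.mul_one]

omit [Fintype V] in
theorem totalDegree_one_sub_LamVar (u v : V) : ((1 - G.LamVar) u v).totalDegree ≤ 1 := by
  rw [Matrix.sub_apply]
  refine (totalDegree_sub _ _).trans (max_le ?_ ?_)
  · rw [Matrix.one_apply]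
    split_ifs <;> simp
  · by_cases h : G.dir u v
    · rw [LamVar_apply_of_dir _ h, totalDegree_X]
    · rw [LamVar_apply_of_not_dir _ h, totalDegree_zero]
      exact Nat.zero_le _

omit [Fintype V] [DecidableEq V] in
theorem totalDegree_sigmaVar (u v : V) : (G.sigmaVar u v).totalDegree ≤ 1 := by
  rw [sigmaVar, Matrix.of_apply, totalDegree_X]

omit [DecidableEq V] in
theorem totalDegree_matrix_mul {M N : Matrix V V (MvPolynomial G.Var ℝ)} {m n : ℕ}
    (hM : ∀ u v, (M u v).totalDegree ≤ m) (hN : ∀ u v, (N u v).totalDegree ≤ n) (u v : V) :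
    ((M * N) u v).totalDegree ≤ m + n := by
  rw [Matrix.mul_apply]
  exact totalDegree_finsetSum_le fun c _ =>
    (totalDegree_mul _ _).trans (Nat.add_le_add (hM u c) (hN c v))

theorem totalDegree_transpose_mul_sigmaVar (u v : V) :
    (((1 - G.LamVar).transpose * G.sigmaVar) u v).totalDegree ≤ 2 :=
  G.totalDegree_matrix_mul (m := 1) (n := 1) (fun u v => G.totalDegree_one_sub_LamVar v u)
    G.totalDegree_sigmaVar u v

theorem totalDegree_transpose_mul_sigmaVar_mul (u v : V) :
    (((1 - G.LamVar).transpose * G.sigmaVar * (1 - G.LamVar)) u v).totalDegree ≤ 3 :=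
  G.totalDegree_matrix_mul G.totalDegree_transpose_mul_sigmaVar G.totalDegree_one_sub_LamVar u v

omit [Fintype V] in
theorem one_sub_LamVar_mem {A : Subalgebra ℝ (MvPolynomial G.Var ℝ)} {u v : V}
    (hA : ∀ h : G.dir u v, X (Sum.inl (Sum.inl ⟨(u, v), h⟩)) ∈ A) : (1 - G.LamVar) u v ∈ A := by
  rw [Matrix.sub_apply]
  refine A.sub_mem ?_ ?_
  · rw [Matrix.one_apply]
    split_ifs
    exacts [A.one_mem, A.zero_mem]
  · by_cases h : G.dir u v
    · rw [LamVar_apply_of_dir _ h]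
      exact hA h
    · rw [LamVar_apply_of_not_dir _ h]
      exact A.zero_mem

omit [Fintype V] [DecidableEq V] in
theorem sigmaVar_mem (T : Set G.Param) (u v : V) :
    G.sigmaVar u v ∈ supported ℝ (Sum.inl '' T ∪ Set.range Sum.inr : Set G.Var) := by
  rw [sigmaVar, Matrix.of_apply]
  exact X_mem_supported.2 (Or.inr ⟨_, rfl⟩)

theorem transpose_mul_sigmaVar_mem {T : Set G.Param} {u : V}
    (hT : ∀ w, ∀ h : G.dir w u, Sum.inl ⟨(w, u), h⟩ ∈ T) (v : V) :
    ((1 - G.LamVar).transpose * G.sigmaVar) u v ∈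
      supported ℝ (Sum.inl '' T ∪ Set.range Sum.inr : Set G.Var) := by
  rw [Matrix.mul_apply]
  refine Subalgebra.sum_mem _ fun c _ => Subalgebra.mul_mem _ ?_ (G.sigmaVar_mem T c v)
  rw [Matrix.transpose_apply]
  exact G.one_sub_LamVar_mem fun h => X_mem_supported.2 (Or.inl ⟨_, hT c h, rfl⟩)

theorem one_notMem_graphIdeal : (1 : MvPolynomial G.Var ℝ) ∉ G.graphIdeal := by
  rw [mem_graphIdeal_iff, map_one]
  exact one_ne_zero

/-- The parameters `ω` are polynomials in `λ` and `σ`. -/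
theorem exists_identifying_omega {r : G.Param → G.Param → Prop}
    (e : {e : Sym2 V // e.IsDiag ∨ e ∈ G.bi.edgeSet}) (hr : ∀ p, r (Sum.inl p) (Sum.inr e)) :
    ∃ g, G.IsIdentifyingPolynomial r (Sum.inr e) g ∧ g.totalDegree ≤ 3 := by
  obtain ⟨e, he⟩ := e
  induction e using Sym2.ind with
  | _ u v =>
  obtain ⟨b, hb⟩ : ∃ b, b = ((1 - G.LamVar).transpose * G.sigmaVar * (1 - G.LamVar)) u v :=
    ⟨_, rfl⟩
  -- All λ are allowed as predecessors, and the coefficient of ω is 1.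
  refine ⟨_, ⟨?_, Set.range Sum.inl, ?_, 1, Subalgebra.one_mem _, b, ?_, rfl,
    G.one_notMem_graphIdeal⟩, ?_⟩
  · rw [mem_graphIdeal_iff, map_sub, mul_one, sub_eq_zero, hb]
    refine Eq.trans ?_ (congrFun (congrFun G.map_transpose_mul_sigmaVar_mul u) v).symm
    rw [substCov, aeval_X, Sum.elim_inl, Omega, Matrix.of_apply, omegaEntry, dif_pos he]
  · rintro _ ⟨p, rfl⟩
    exact hr p
  · rw [hb, Matrix.mul_apply]
    refine Subalgebra.sum_mem _ fun c _ => Subalgebra.mul_mem _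
      (G.transpose_mul_sigmaVar_mem (fun w h => Set.mem_range_self _) c) ?_
    exact G.one_sub_LamVar_mem fun h => X_mem_supported.2
      (Or.inl (Set.mem_image_of_mem _ (Set.mem_range_self _)))
  · have hbd : b.totalDegree ≤ 3 := by
      rw [hb]
      exact G.totalDegree_transpose_mul_sigmaVar_mul u v
    rw [mul_one]
    refine (totalDegree_sub _ _).trans (max_le ?_ hbd)
    rw [totalDegree_X]
    norm_num

end MixedGraph

/-! ## Half-trek systems without sided intersection -/

namespace MixedGraph

variable {V : Type u} (G : MixedGraph V)

/-- A system of half-treks from the elements `y` of `Y` to `t y`, whose right sides `R y`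
are pairwise disjoint. -/
structure IsHalfTrekSystem {Y : Set V} (t : Y → V) (R : Y → List V) : Prop where
  halfTrek : ∀ y, G.IsHalfTrek (R y) y (t y)
  disjoint : ∀ y y', y ≠ y' → (R y).Disjoint (R y')

/-- A half-trek system is reduced if it cannot be shortened by exchanging half-treks. -/
def IsReducedSystem {Y : Set V} (R : Y → List V) : Prop :=
  ∀ π : Equiv.Perm Y, (∀ y, π y = y ∨ (y : V) ∈ R (π y)) →
    ∀ y, (y : V) ∈ R (π y) → π y = y ∧ (R y).head? = some (y : V)

open Classical in
/-- The number of edges of a half-trek with right side `R` from `y`, plus one. -/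
noncomputable def halfTrekCost (R : List V) (y : V) : ℕ :=
  R.length + if R.head? = some y then 0 else 1

variable {G} {Y : Set V} {t : Y → V} {R : Y → List V}

theorem IsHalfTrekSystem.eq_of_mem (h : G.IsHalfTrekSystem t R) {y y' : Y} {x : V}
    (hx : x ∈ R y) (hx' : x ∈ R y') : y = y' := by
  by_contra hne
  exact h.disjoint y y' hne hx hx'

/-- The tail starting at a node `y` of the right side is a half-trek from `y` that uses no
bidirected edge. -/
theorem IsHalfTrek.drop {l s tl : List V} {u v y : V} (h : G.IsHalfTrek l u v)
    (hl : l = s ++ y :: tl) : G.IsHalfTrek (y :: tl) y v := by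
  subst hl
  obtain ⟨-, h2, -, h4, -, h6, -⟩ := h
  refine ⟨by simp, h2.right_of_append, by simp, h4.of_append_right, rfl, ?_,
    y, y, rfl, rfl, Or.inl rfl⟩
  rw [List.getLast?_append_of_ne_nil _ (by simp)] at h6
  exact h6

/-- Each `y` lying on the right side of `π y` takes over the tail from `y`; the others keep their
half-treks. The new right sides are contained in the old ones, so they stay disjoint, and the cost
drops at `y₀`. -/
theorem IsHalfTrekSystem.exists_exchange [Fintype Y] (h : G.IsHalfTrekSystem t R)
    {π : Equiv.Perm Y} (hπ : ∀ y, π y = y ∨ (y : V) ∈ R (π y)) {y₀ : Y}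
    (hy₀ : (y₀ : V) ∈ R (π y₀)) (hne : ¬ (π y₀ = y₀ ∧ (R y₀).head? = some (y₀ : V))) :
    ∃ R', G.IsHalfTrekSystem (t ∘ π) R' ∧
      ∑ y, halfTrekCost (R' y) y < ∑ y, halfTrekCost (R y) y := by
  classical
  have key : ∀ y : Y, ∃ l, G.IsHalfTrek l y (t (π y)) ∧ (∀ x ∈ l, x ∈ R (π y)) ∧
      halfTrekCost l y ≤ halfTrekCost (R (π y)) (π y) ∧
      ((y : V) ∈ R (π y) → ¬ (π y = y ∧ (R y).head? = some (y : V)) →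
        halfTrekCost l y < halfTrekCost (R (π y)) (π y)) := by
    intro y
    by_cases hy : (y : V) ∈ R (π y)
    · obtain ⟨s, tl, hs⟩ := List.append_of_mem hy
      refine ⟨y :: tl, (h.halfTrek (π y)).drop hs, fun x hx => ?_, ?_, fun _ hbad => ?_⟩
      · rw [hs]
        exact List.mem_append_right _ hx
      · simp only [halfTrekCost, hs, List.length_append, List.head?_cons, if_true]
        omega
      · simp only [halfTrekCost, hs, List.length_append, List.head?_cons, if_true]
        -- If no node is cut off, then `π y ≠ y`, and the saving is the bidirected edge from `π y`
        -- to `y`.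
        rcases s with - | ⟨a, s⟩
        · have : (y : V) ≠ π y := by
            intro he
            have he' : π y = y := Subtype.ext he.symm
            refine hbad ⟨he', ?_⟩
            rw [he'] at hs
            rw [hs]
            rfl
          simp [this]
        · simp only [List.length_cons]
          omega
    · have he := (hπ y).resolve_right hy
      refine ⟨R y, ?_, fun x hx => ?_, ?_, fun h1 => absurd h1 hy⟩
      · rw [he]
        exact h.halfTrek y
      · rwa [he]
      · rw [he]
  choose R' h1 h2 h3 h4 using key
  refine ⟨R', ⟨h1, fun y y' hyy x hx hx' => ?_⟩, ?_⟩
  · exact hyy (π.injective (h.eq_of_mem (h2 y x hx) (h2 y' x hx')))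
  · rw [← Equiv.sum_comp π fun y => halfTrekCost (R y) y]
    exact Finset.sum_lt_sum (fun y _ => h3 y) ⟨y₀, Finset.mem_univ _, h4 y₀ hy₀ hne⟩

theorem IsHalfTrekSystem.exists_reduced [Fintype Y] (h : G.IsHalfTrekSystem t R) :
    ∃ (π : Equiv.Perm Y) (R' : Y → List V), G.IsHalfTrekSystem (t ∘ π) R' ∧
      IsReducedSystem R' := by
  induction hn : ∑ y, halfTrekCost (R y) y using Nat.strong_induction_on generalizing t R with
  | _ n ih =>
  by_cases hred : IsReducedSystem R
  · exact ⟨1, R, h, hred⟩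
  · simp only [IsReducedSystem] at hred
    push Not at hred
    obtain ⟨π, hπ, y, hy, hbad⟩ := hred
    obtain ⟨R', hR', hlt⟩ := h.exists_exchange hπ hy (fun hc => hbad hc.1 hc.2)
    obtain ⟨π', R'', h1, h2⟩ := ih _ (hn ▸ hlt) hR' rfl
    exact ⟨π'.trans π, R'', h1, h2⟩

/-! ### The precedence relation of a reduced system -/

section Precedence

/-- `a` is followed by `b` in one of the right sides. -/
def Consecutive (R : Y → List V) (a b : V) : Prop :=
  ∃ z i, (R z)[i]? = some a ∧ (R z)[i + 1]? = some b

open Classical in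
/-- The element of `Y` whose half-trek has `y` on its right side, or `y` if there is none. -/
noncomputable def owner (R : Y → List V) (y : Y) : Y :=
  if h : ∃ z, (y : V) ∈ R z then h.choose else y

theorem owner_eq_or_mem (y : Y) : owner R y = y ∨ (y : V) ∈ R (owner R y) := by
  unfold owner
  split_ifs with h
  · exact Or.inr h.choose_spec
  · exact Or.inl rfl

theorem IsHalfTrekSystem.owner_eq (h : G.IsHalfTrekSystem t R) {y z : Y} (hy : (y : V) ∈ R z) :
    owner R y = z := by
  have hz : ∃ z, (y : V) ∈ R z := ⟨z, hy⟩
  rw [owner, dif_pos hz]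
  exact h.eq_of_mem hz.choose_spec hy

/-- On its periodic points `owner` is a permutation. Extended by the identity it is an admissible
exchange, so reducedness forces it to be trivial. -/
theorem IsReducedSystem.owner_eq_self [Finite Y] (hR : IsReducedSystem R) {y : Y}
    (hy : y ∈ Function.periodicPts (owner R)) : owner R y = y := by
  classical
  have hb := Function.bijOn_periodicPts (owner R)
  let g : Y → Y := fun y => if y ∈ Function.periodicPts (owner R) then owner R y else y
  have hg : Function.Injective g := by
    intro a b hab
    simp only [g] at hab
    split_ifs at hab with ha hb' hb'
    · exact hb.injOn ha hb' hab
    · exact absurd (hab ▸ hb.mapsTo ha) hb'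
    · exact absurd (hab ▸ hb.mapsTo hb') ha
    · exact hab
  have key : ∀ y, g y = y ∨ (y : V) ∈ R (g y) := by
    intro y
    simp only [g]
    split_ifs
    · exact owner_eq_or_mem y
    · exact Or.inl rfl
  have hgy : g y = owner R y := if_pos hy
  rcases owner_eq_or_mem (R := R) y with h | h
  · exact h
  · rw [← hgy] at h ⊢
    exact (hR (Equiv.ofBijective g (Finite.injective_iff_bijective.1 hg)) key y h).1

theorem IsReducedSystem.head?_eq (hR : IsReducedSystem R) {y : Y} (hy : (y : V) ∈ R y) :
    (R y).head? = some (y : V) :=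
  (hR 1 (fun _ => Or.inl rfl) y hy).2

theorem Consecutive.dir (h : G.IsHalfTrekSystem t R) {a b : V} (hab : Consecutive R a b) :
    G.dir a b := by
  obtain ⟨z, i, h1, h2⟩ := hab
  obtain ⟨hi, rfl⟩ := List.getElem?_eq_some_iff.1 h1
  obtain ⟨hi', rfl⟩ := List.getElem?_eq_some_iff.1 h2
  exact List.isChain_iff_getElem.1 (h.halfTrek z).2.1 i hi'

theorem Consecutive.mem_iff (h : G.IsHalfTrekSystem t R) {a b : V} (hab : Consecutive R a b)
    (z : Y) : a ∈ R z ↔ b ∈ R z := by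
  obtain ⟨z', i, h1, h2⟩ := hab
  have ha := List.mem_of_getElem? h1
  have hb := List.mem_of_getElem? h2
  constructor
  · intro hz
    rwa [h.eq_of_mem hz ha]
  · intro hz
    rwa [h.eq_of_mem hz hb]

theorem Consecutive.left_unique (h : G.IsHalfTrekSystem t R) {a a' b : V}
    (hab : Consecutive R a b) (hab' : Consecutive R a' b) : a = a' := by
  obtain ⟨z, i, h1, h2⟩ := hab
  obtain ⟨z', i', h1', h2'⟩ := hab'
  obtain rfl := h.eq_of_mem (List.mem_of_getElem? h2) (List.mem_of_getElem? h2')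
  have h3 := (h.halfTrek z).2.2.2.1
  have h4 := (List.getElem?_inj (List.getElem?_eq_some_iff.1 h2).1 h3).1 (h2.trans h2'.symm)
  have h5 : i = i' := by omega
  subst h5
  exact Option.some_injective _ (h1.symm.trans h1')

theorem Consecutive.head?_ne (h : G.IsHalfTrekSystem t R) {a b : V} (hab : Consecutive R a b)
    (z : Y) : (R z).head? ≠ some b := by
  obtain ⟨z', i, h1, h2⟩ := hab
  intro hz
  obtain rfl := h.eq_of_mem (List.mem_of_getElem? h2) (List.mem_of_mem_head? hz)
  rw [List.head?_eq_getElem?] at hz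
  have h3 := (h.halfTrek z').2.2.2.1
  have h4 := (List.getElem?_inj (List.getElem?_eq_some_iff.1 h2).1 h3).1 (h2.trans hz.symm)
  omega

/-- `a` does not come after `b` in one of the right sides, or `a = b`. -/
abbrev Precedes (R : Y → List V) : V → V → Prop := Relation.ReflTransGen (Consecutive R)

theorem Precedes.mem_iff (h : G.IsHalfTrekSystem t R) {a b : V} (hab : Precedes R a b) (z : Y) :
    a ∈ R z ↔ b ∈ R z := by
  induction hab with
  | refl => rfl
  | tail _ hbc ih => rw [ih, hbc.mem_iff h]

theorem precedes_of_head? {z : Y} {b c : V} (hb : (R z).head? = some b) (hc : c ∈ R z) :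
    Precedes R b c := by
  obtain ⟨i, hi, rfl⟩ := List.getElem_of_mem hc
  clear hc
  induction i with
  | zero =>
    rw [List.head?_eq_getElem?, List.getElem?_eq_getElem hi] at hb
    rw [Option.some_injective _ hb]
  | succ i ih =>
    exact (ih (by omega)).tail ⟨z, i, List.getElem?_eq_getElem _, List.getElem?_eq_getElem _⟩

theorem IsHalfTrekSystem.not_transGen (h : G.IsHalfTrekSystem t R) (a : V) :
    ¬ Relation.TransGen (Consecutive R) a a := fun ha =>
  G.acyclic a (Relation.TransGen.mono (fun _ _ hab => Consecutive.dir h hab) a a ha)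

theorem Precedes.antisymm (h : G.IsHalfTrekSystem t R) {a b : V} (hab : Precedes R a b)
    (hba : Precedes R b a) : a = b := by
  rcases Relation.reflTransGen_iff_eq_or_transGen.1 hab with h1 | h1
  · exact h1.symm
  · exact absurd (h1.trans_left hba) (h.not_transGen a)

theorem Precedes.head?_ne (h : G.IsHalfTrekSystem t R) {a b : V} (hab : Precedes R a b)
    (hne : a ≠ b) (z : Y) : (R z).head? ≠ some b := by
  rcases Relation.ReflTransGen.cases_tail hab with h1 | ⟨c, -, hc⟩
  · exact absurd h1.symm hne
  · exact hc.head?_ne h z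

/-- `z` owns `y`, and `z ≠ y`. -/
def Owns (R : Y → List V) (z y : Y) : Prop := owner R y = z ∧ z ≠ y

/-- Everything after `b` on the right side of `a` is owned by `a`. It is not `a` itself, since in a
reduced system `a` can only be the head of its own right side. -/
theorem Owns.of_precedes (h : G.IsHalfTrekSystem t R) (hR : IsReducedSystem R) {a b c : Y}
    (hab : Owns R a b) (hbc : Precedes R b c) (hne : b ≠ c) : Owns R a c := by
  obtain ⟨h1, h2⟩ := hab
  have hb : (b : V) ∈ R a := by
    rcases owner_eq_or_mem (R := R) b with h3 | h3
    · exact absurd (h1.symm.trans h3) h2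
    · rwa [h1] at h3
  have hc : (c : V) ∈ R a := (Precedes.mem_iff h hbc a).1 hb
  refine ⟨h.owner_eq hc, ?_⟩
  rintro rfl
  exact Precedes.head?_ne h hbc (fun he => hne (Subtype.ext he)) a (hR.head?_eq hc)

theorem not_transGen_owns [Finite Y] (hR : IsReducedSystem R) (y : Y) :
    ¬ Relation.TransGen (Owns R) y y := by
  have key : ∀ a b, Relation.TransGen (Owns R) a b → ∃ n, 0 < n ∧ (owner R)^[n] b = a := by
    intro a b hab
    induction hab with
    | single h => exact ⟨1, one_pos, h.1⟩
    | tail _ h ih =>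
      obtain ⟨n, hn, h1⟩ := ih
      exact ⟨n + 1, Nat.succ_pos n, by rw [Function.iterate_succ_apply, h.1, h1]⟩
  intro hy
  obtain ⟨n, hn, h1⟩ := key y y hy
  have h2 := hR.owner_eq_self (Function.mk_mem_periodicPts hn h1)
  rcases Relation.TransGen.tail'_iff.1 hy with ⟨c, -, hc⟩
  exact hc.2 (hc.1.symm.trans h2)

/-- `z` comes before `y` on a right side, or owns `y`. -/
def Dominates (R : Y → List V) (z y : Y) : Prop := z ≠ y ∧ (Precedes R z y ∨ owner R y = z)

/-- A precedence step after an ownership step can be absorbed into it. Every chain thus collapses to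
precedence alone, or to precedence followed by ownership; both relations are acyclic. -/
theorem not_transGen_dominates [Finite Y] (h : G.IsHalfTrekSystem t R) (hR : IsReducedSystem R)
    (y : Y) : ¬ Relation.TransGen (Dominates R) y y := by
  have absorb : ∀ a b c : Y, Relation.TransGen (Owns R) a b → Precedes R b c → b ≠ c →
      Relation.TransGen (Owns R) a c := by
    intro a b c hab hbc hne
    cases hab with
    | single h1 => exact .single (h1.of_precedes h hR hbc hne)
    | tail h1 h2 => exact h1.tail (h2.of_precedes h hR hbc hne)
  have key : ∀ a b, Relation.TransGen (Dominates R) a b →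
      (Precedes R a b ∧ a ≠ b) ∨ ∃ m : Y, Precedes R a m ∧ Relation.TransGen (Owns R) m b := by
    intro a b hab
    induction hab with
    | single h1 =>
      rcases h1 with ⟨hne, h1 | h1⟩
      · exact Or.inl ⟨h1, hne⟩
      · exact Or.inr ⟨a, .refl, .single ⟨h1, hne⟩⟩
    | @tail b c _ h1 ih =>
      rcases h1 with ⟨hne, h1 | h1⟩
      · rcases ih with ⟨h2, h3⟩ | ⟨m, h2, h3⟩
        · refine Or.inl ⟨h2.trans h1, ?_⟩
          rintro rfl
          exact h3 (Subtype.ext (Precedes.antisymm h h2 h1))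
        · exact Or.inr ⟨m, h2, absorb _ _ _ h3 h1 hne⟩
      · rcases ih with ⟨h2, -⟩ | ⟨m, h2, h3⟩
        · exact Or.inr ⟨b, h2, .single ⟨h1, hne⟩⟩
        · exact Or.inr ⟨m, h2, h3.tail ⟨h1, hne⟩⟩
  intro hy
  rcases key y y hy with ⟨-, h1⟩ | ⟨m, h1, h2⟩
  · exact h1 rfl
  · by_cases hm : y = m
    · subst hm
      exact not_transGen_owns hR y h2
    -- The cycle is rotated to start at `m`, so that its precedence step comes last and is absorbed.
    · exact not_transGen_owns hR m (absorb _ _ _ h2 h1 hm)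

theorem exists_dominance_rank [Finite Y] (h : G.IsHalfTrekSystem t R) (hR : IsReducedSystem R) :
    ∃ ρ : Y → ℕ, ∀ z y, Dominates R z y → ρ y < ρ z := by
  refine ⟨fun y => {z | Relation.TransGen (Dominates R) y z}.ncard, fun z y hzy => ?_⟩
  refine Set.ncard_lt_ncard ⟨fun a ha => Relation.TransGen.head hzy ha, fun hs => ?_⟩
    (Set.toFinite _)
  exact not_transGen_dominates h hR y (hs (Relation.TransGen.single hzy))

end Precedence

end MixedGraph

/-! ## Nonvanishing of the determinant -/

namespace MixedGraph

variable {V : Type u} {G : MixedGraph V} {Y : Set V} {t : Y → V} {R : Y → List V}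

/-- The first node on the right side of the half-trek from `y`. -/
def headOf (R : Y → List V) (y : Y) : V := (R y).head?.getD y

/-- Right sides are nonempty, so the default value in `headOf` is never reached. -/
theorem IsHalfTrekSystem.head?_eq (h : G.IsHalfTrekSystem t R) (y : Y) :
    (R y).head? = some (headOf R y) := by
  obtain ⟨-, -, -, -, -, -, a, b, -, hb, -⟩ := h.halfTrek y
  rw [headOf, hb, Option.getD_some]

theorem IsHalfTrekSystem.isDiag_or_mem_edgeSet (h : G.IsHalfTrekSystem t R) (y : Y) :
    s((y : V), headOf R y).IsDiag ∨ s((y : V), headOf R y) ∈ G.bi.edgeSet := by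
  have h1 := h.head?_eq y
  obtain ⟨-, -, -, -, -, -, a, b, ha, hb, hab⟩ := h.halfTrek y
  obtain rfl : (y : V) = a := Option.some_injective _ ha
  obtain rfl : headOf R y = b := Option.some_injective _ (h1.symm.trans hb)
  exact hab.imp (fun h => Sym2.mk_isDiag_iff.2 h) fun h => h

theorem IsHalfTrekSystem.mem_target (h : G.IsHalfTrekSystem t R) (y : Y) : t y ∈ R y :=
  List.mem_of_getLast? (h.halfTrek y).2.2.2.2.2.1

open Classical in
/-- The specialization to the edges of a half-trek system, with weights that are powers of a
variable on the bidirected part. -/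
noncomputable def specialize [Fintype Y] (G : MixedGraph V) (R : Y → List V) (ρ : Y → ℕ) :
    MvPolynomial G.Param ℝ →ₐ[ℝ] Polynomial ℝ :=
  aeval (Sum.elim (fun e => if Consecutive R e.1.1 e.1.2 then 1 else 0)
    fun e => ∑ z : Y, if (e : Sym2 V) = s((z : V), headOf R z) then Polynomial.X ^ ρ z else 0)

open Classical in
theorem specialize_Lam [Fintype Y] (h : G.IsHalfTrekSystem t R) (ρ : Y → ℕ) (a b : V) :
    specialize G R ρ (G.Lam a b) = if Consecutive R a b then 1 else 0 := by
  by_cases hab : G.dir a b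
  · rw [Lam_apply_of_dir _ hab, specialize, aeval_X, Sum.elim_inl]
  · rw [Lam_apply_of_not_dir _ hab, map_zero, if_neg fun h' => hab (Consecutive.dir h h')]

open Classical in
theorem specialize_Omega [Fintype Y] (h : G.IsHalfTrekSystem t R) (ρ : Y → ℕ) (a b : V) :
    specialize G R ρ (G.Omega a b) =
      ∑ z : Y, if s(a, b) = s((z : V), headOf R z) then Polynomial.X ^ ρ z else 0 := by
  rw [Omega, Matrix.of_apply, omegaEntry]
  split_ifs with hab
  · rw [specialize, aeval_X, Sum.elim_inr]
  · rw [map_zero]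
    refine (Finset.sum_eq_zero fun z _ => if_neg fun he => hab ?_).symm
    rw [he]
    exact h.isDiag_or_mem_edgeSet z

variable [Fintype V] [DecidableEq V]

-- The edges kept form disjoint paths, so at most one directed walk joins two nodes and the path
-- matrix has entries 0 and 1.
open Classical in
theorem specialize_inv [Fintype Y] (h : G.IsHalfTrekSystem t R) (ρ : Y → ℕ) :
    ((1 - G.Lam)⁻¹).map (specialize G R ρ) =
      Matrix.of fun a b => if Precedes R a b then 1 else 0 := by
  set K : Matrix V V (Polynomial ℝ) := Matrix.of fun a b => if Precedes R a b then 1 else 0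
  have h1 : K * (1 - G.Lam).map (specialize G R ρ) = 1 := by
    ext1 a b
    rw [Matrix.map_sub _ (map_sub _), Matrix.map_one _ (map_zero _) (map_one _), Matrix.mul_sub,
      Matrix.mul_one, Matrix.sub_apply, Matrix.mul_apply]
    simp only [Matrix.map_apply, specialize_Lam h, mul_ite, mul_one, mul_zero, K, Matrix.of_apply]
    -- The product has entry `K a b - K a c` if `b` has the (unique) predecessor `c`, and `K a b` if
    -- it has none.
    by_cases hp : ∃ c, Consecutive R c b
    · obtain ⟨c, hc⟩ := hp
      rw [Finset.sum_eq_single c, if_pos hc]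
      · by_cases hab : a = b
        · subst hab
          rw [if_pos .refl, if_neg, Matrix.one_apply_eq, sub_zero]
          intro hac
          exact h.not_transGen c (Relation.TransGen.head' hc hac)
        · have : Precedes R a b ↔ Precedes R a c := by
            constructor
            · intro hab'
              rcases Relation.ReflTransGen.cases_tail hab' with h2 | ⟨d, hd, hdb⟩
              · exact absurd h2.symm hab
              · rwa [hc.left_unique h hdb]
            · exact fun hac => hac.tail hc
          simp only [this, sub_self, Matrix.one_apply_ne hab]
      · intro d _ hd
        exact if_neg fun hdb => hd (hdb.left_unique h hc)
      · exact fun hc' => absurd (Finset.mem_univ c) hc'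
    · rw [Finset.sum_eq_zero fun c _ => if_neg fun hc => hp ⟨c, hc⟩, sub_zero, Matrix.one_apply]
      congr 1
      refine propext ⟨fun hab => ?_, fun hab => hab ▸ .refl⟩
      rcases Relation.ReflTransGen.cases_tail hab with h2 | ⟨d, -, hdb⟩
      · exact h2.symm
      · exact absurd ⟨d, hdb⟩ hp
  have h2 : (1 - G.Lam).map (specialize G R ρ) * ((1 - G.Lam)⁻¹).map (specialize G R ρ) = 1 := by
    rw [← Matrix.map_mul, Matrix.mul_nonsing_inv _ G.isUnit_det_one_sub_Lam,
      Matrix.map_one _ (map_zero _) (map_one _)]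
  exact (left_inv_eq_right_inv h1 h2).symm

open Classical in
/-- The matrix whose rows indexed by `Z` are those of `(I - Λ)ᵀ τ_G(Σ)` and whose other rows are
those of `τ_G(Σ)`. -/
noncomputable def htcMatrix (G : MixedGraph V) {Y : Set V} (Z : Set V) (t : Y → V) :
    Matrix Y Y (MvPolynomial G.Param ℝ) :=
  Matrix.of fun y y' => if (y : V) ∈ Z then (G.Omega * (1 - G.Lam)⁻¹) y (t y')
    else G.covMatrix y (t y')

-- Both kinds of rows come from NᵀΩ(I-Λ)⁻¹, with N = I or N = (I-Λ)⁻¹, and can be expanded together.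
open Classical in
theorem htcMatrix_apply_eq_sum (Z : Set V) (t : Y → V) (y y' : Y) :
    htcMatrix G Z t y y' = ∑ a, ∑ c, (if (y : V) ∈ Z then (1 : Matrix V V _) else (1 - G.Lam)⁻¹) a y *
      G.Omega a c * (1 - G.Lam)⁻¹ c (t y') := by
  have key : ∀ N : Matrix V V (MvPolynomial G.Param ℝ),
      ∑ a, ∑ c, N a y * G.Omega a c * (1 - G.Lam)⁻¹ c (t y') =
        (N.transpose * (G.Omega * (1 - G.Lam)⁻¹)) y (t y') := by
    intro N
    simp only [Matrix.mul_apply, Finset.mul_sum, Matrix.transpose_apply, mul_assoc]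
  rw [htcMatrix, Matrix.of_apply, key]
  split_ifs
  · rw [Matrix.transpose_one, Matrix.one_mul]
  · rw [covMatrix, Matrix.mul_assoc]

/-- The term that follows the half-trek of `y` gives `X ^ ρ y` exactly when it reaches `t y'`, that
is, when `y = y'`. Any other nonzero term uses the initial edge of some `z` with one end preceding
`y`: if that end is `z`, then `z` precedes `y`; if it is the head, then `z` owns `y`. So `z`
dominates `y` and the power of `X` is higher. -/
theorem specialize_htcMatrix [Fintype Y] (h : G.IsHalfTrekSystem t R) (hR : IsReducedSystem R)
    {ρ : Y → ℕ} (hρ : ∀ z y, Dominates R z y → ρ y < ρ z) (Z : Set V) (y y' : Y) :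
    ∃ e, specialize G R ρ (htcMatrix G Z t y y') =
      Polynomial.X ^ ρ y * ((1 : Matrix Y Y (Polynomial ℝ)) y y' + Polynomial.X * e) := by
  classical
  set L : V → Polynomial ℝ := fun a =>
    if (y : V) ∈ Z then (1 : Matrix V V (Polynomial ℝ)) a y else if Precedes R a y then 1 else 0
    with hL
  set K : V → Polynomial ℝ := fun c => if Precedes R c (t y') then 1 else 0 with hK
  let F : V × V × Y → Polynomial ℝ := fun p =>
    L p.1 * (if s(p.1, p.2.1) = s((p.2.2 : V), headOf R p.2.2) then Polynomial.X ^ ρ p.2.2 else 0) *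
      K p.2.1
  have hinv : ∀ a b, specialize G R ρ ((1 - G.Lam)⁻¹ a b) = if Precedes R a b then 1 else 0 :=
    fun a b => congrFun (congrFun (specialize_inv h ρ) a) b
  have hLa : ∀ a, specialize G R ρ
      ((if (y : V) ∈ Z then (1 : Matrix V V _) else (1 - G.Lam)⁻¹) a y) = L a := by
    intro a
    simp only [hL]
    split_ifs with hZ hp
    · rw [Matrix.one_apply, Matrix.one_apply]
      split_ifs <;> simp
    · rw [hinv, if_pos hp]
    · rw [hinv, if_neg hp]
  have hsum : specialize G R ρ (htcMatrix G Z t y y') = ∑ p, F p := by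
    rw [htcMatrix_apply_eq_sum, map_sum, Fintype.sum_prod_type]
    refine Finset.sum_congr rfl fun a _ => ?_
    rw [map_sum, Fintype.sum_prod_type]
    refine Finset.sum_congr rfl fun c _ => ?_
    rw [map_mul, map_mul, hLa, specialize_Omega h, hinv, Finset.mul_sum, Finset.sum_mul]
    refine Finset.sum_congr rfl fun z _ => ?_
    simp only [F, hK]
    congr!
  have hLy : L y = 1 := by
    simp only [hL]
    split_ifs with h1 h2
    · exact Matrix.one_apply_eq _
    · rfl
    · exact absurd .refl h2
  have hLp : ∀ a, L a ≠ 0 → Precedes R a y := by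
    intro a ha
    by_contra hp
    apply ha
    simp only [hL]
    split_ifs
    · rw [Matrix.one_apply_ne]
      rintro rfl
      exact hp .refl
    · rfl
  have hmain : F (y, headOf R y, y) =
      Polynomial.X ^ ρ y * (1 : Matrix Y Y (Polynomial ℝ)) y y' := by
    have : Precedes R (headOf R y) (t y') ↔ y = y' := by
      have hmem : headOf R y ∈ R y := List.mem_of_mem_head? (h.head?_eq y)
      constructor
      · intro hp
        exact h.eq_of_mem ((Precedes.mem_iff h hp y).1 hmem) (h.mem_target y')
      · rintro rfl
        exact precedes_of_head? (h.head?_eq y) (h.mem_target y)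
    simp only [F, hLy, if_true, one_mul, hK, this, Matrix.one_apply]
  have hrest : ∀ p ∈ Finset.univ.erase (((y : V), headOf R y, y) : V × V × Y),
      Polynomial.X ^ (ρ y + 1) ∣ F p := by
    rintro ⟨a, c, z⟩ hp
    have hp' := Finset.ne_of_mem_erase hp
    by_cases hLa0 : L a = 0
    · simp [F, hLa0]
    have hay := hLp a hLa0
    simp only [F]
    split_ifs with hs
    · suffices hd : Dominates R z y by
        exact ((pow_dvd_pow _ (hρ z y hd)).mul_left _).mul_right _
      rw [Sym2.eq_iff] at hs
      rcases hs with ⟨rfl, rfl⟩ | ⟨rfl, rfl⟩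
      · refine ⟨?_, Or.inl hay⟩
        rintro rfl
        exact hp' rfl
      · have hmem : (y : V) ∈ R z :=
          (Precedes.mem_iff h hay z).1 (List.mem_of_mem_head? (h.head?_eq z))
        -- For `z = y`, reducedness makes `y` its own head, and the term would be the main one.
        refine ⟨?_, Or.inr (h.owner_eq hmem)⟩
        rintro rfl
        have h1 := Option.some_injective _ ((h.head?_eq z).symm.trans (hR.head?_eq hmem))
        exact hp' (by rw [h1])
    · simp
  obtain ⟨e, he⟩ := Finset.dvd_sum hrest
  refine ⟨e, ?_⟩
  rw [hsum, ← Finset.add_sum_erase _ _ (Finset.mem_univ (((y : V), headOf R y, y) : V × V × Y)),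
    hmain, he]
  ring

/-- The factor `1 + X E` has determinant 1 at `X = 0`. -/
theorem IsHalfTrekSystem.det_htcMatrix_ne_zero [Fintype Y] [DecidableEq Y]
    (h : G.IsHalfTrekSystem t R) (hR : IsReducedSystem R) (Z : Set V) :
    (htcMatrix G Z t).det ≠ 0 := by
  obtain ⟨ρ, hρ⟩ := exists_dominance_rank h hR
  choose E hE using specialize_htcMatrix h hR hρ Z
  have h1 : (htcMatrix G Z t).map (specialize G R ρ) =
      Matrix.diagonal (fun y => Polynomial.X ^ ρ y) *
        (1 + Matrix.of fun y y' => Polynomial.X * E y y') := by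
    ext1 y y'
    rw [Matrix.map_apply, hE, Matrix.diagonal_mul, Matrix.add_apply, Matrix.of_apply]
    congr!
  have h2 : (1 + Matrix.of fun y y' => Polynomial.X * E y y' : Matrix Y Y (Polynomial ℝ)).det ≠
      0 := by
    intro h0
    have h3 := congrArg (Polynomial.evalRingHom 0) h0
    rw [RingHom.map_det, map_zero] at h3
    have h4 : (Polynomial.evalRingHom (0 : ℝ)).mapMatrix
        (1 + Matrix.of fun y y' => Polynomial.X * E y y' : Matrix Y Y (Polynomial ℝ)) = 1 := by
      rw [map_add, map_one, add_eq_left]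
      ext1 y y'
      simp
    rw [h4, Matrix.det_one] at h3
    exact one_ne_zero h3
  intro h0
  have h3 : ((htcMatrix G Z t).map (specialize G R ρ)).det = 0 := by
    have := (specialize G R ρ).toRingHom.map_det (htcMatrix G Z t)
    rw [h0, map_zero] at this
    exact this.symm
  rw [h1, Matrix.det_mul, Matrix.det_diagonal] at h3
  exact mul_ne_zero (Finset.prod_ne_zero_iff.2 fun y _ => pow_ne_zero _ Polynomial.X_ne_zero) h2 h3

theorem SatisfiesHTC.exists_target {v : V} [Fintype Y] [DecidableEq Y] (hY : G.SatisfiesHTC Y v) :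
    ∃ t : Y → V, Function.Injective t ∧ Set.range t = G.pa v ∧
      ∀ Z, (htcMatrix G Z t).det ≠ 0 := by
  obtain ⟨-, -, t, R, ht, hR, hdisj⟩ := hY
  have hsys : G.IsHalfTrekSystem (fun y : Y => t y) (fun y : Y => R y) :=
    ⟨fun y => hR y y.2, fun y y' hne => hdisj y y.2 y' y'.2 fun he => hne (Subtype.ext he)⟩
  obtain ⟨π, R', h1, h2⟩ := hsys.exists_reduced
  refine ⟨_, ?_, ?_, fun Z => h1.det_htcMatrix_ne_zero h2 Z⟩
  · exact Function.Injective.comp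
      (fun y y' he => Subtype.ext (ht.injOn y.2 y'.2 he)) π.injective
  · rw [π.surjective.range_comp, ← ht.image_eq, Set.image_eq_range]

end MixedGraph

/-! ## Identifying polynomials from the half-trek criterion -/

namespace MixedGraph

variable {V : Type u} {G : MixedGraph V} [Fintype V] [DecidableEq V] {Y : Set V}

theorem omega_mul_inv_mul_one_sub_Lam_eq_zero {y v : V} (hyv : y ≠ v) (hadj : ¬ G.bi.Adj y v) :
    (G.Omega * (1 - G.Lam)⁻¹ * (1 - G.Lam)) y v = 0 := by
  rw [Matrix.mul_assoc, inv_mul_one_sub_Lam, Matrix.mul_one, Omega, Matrix.of_apply, omegaEntry,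
    dif_neg]
  rintro (h | h)
  · exact hyv (Sym2.mk_isDiag_iff.1 h)
  · exact hadj h

/-- A nonzero term of (I-Λ)⁻ᵀΩ at (y, v) would yield a half-trek from `v` to `y`. -/
theorem covMatrix_mul_one_sub_Lam_eq_zero {y v : V} (hyv : y ≠ v) (hadj : ¬ G.bi.Adj y v)
    (htr : y ∉ G.htr v) : (G.covMatrix * (1 - G.Lam)) y v = 0 := by
  rw [covMatrix_mul_one_sub_Lam, Matrix.mul_apply]
  refine Finset.sum_eq_zero fun a _ => ?_
  by_contra h
  have h1 := G.reflTransGen_of_inv_ne_zero (left_ne_zero_of_mul h)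
  have h2 := right_ne_zero_of_mul h
  rw [Omega, Matrix.of_apply, omegaEntry] at h2
  split_ifs at h2 with h3
  · refine htr (G.mem_htr_of_reflTransGen h1 ?_ hyv fun h => hadj h.symm)
    rcases h3 with h3 | h3
    · exact Or.inl (Sym2.mk_isDiag_iff.1 h3).symm
    · exact Or.inr (SimpleGraph.Adj.symm h3)
  · exact h2 rfl

variable (G) in
open Classical in
/-- The row of index `y` of the linear system for the coefficients at `v`. -/
noncomputable def htcRow (Z : Set V) (y : V) : V → MvPolynomial G.Var ℝ :=
  if y ∈ Z then ((1 - G.LamVar).transpose * G.sigmaVar) y else G.sigmaVar y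

theorem totalDegree_htcRow (Z : Set V) (y w : V) : (G.htcRow Z y w).totalDegree ≤ 2 := by
  rw [htcRow]
  split_ifs
  · exact G.totalDegree_transpose_mul_sigmaVar y w
  · exact (G.totalDegree_sigmaVar y w).trans one_le_two

theorem htcRow_mem {Z : Set V} {T : Set G.Param} {y : V}
    (hT : y ∈ Z → ∀ w, ∀ h : G.dir w y, Sum.inl ⟨(w, y), h⟩ ∈ T) (w : V) :
    G.htcRow Z y w ∈ supported ℝ (Sum.inl '' T ∪ Set.range Sum.inr : Set G.Var) := by
  rw [htcRow]
  split_ifs with h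
  · exact G.transpose_mul_sigmaVar_mem (hT h) w
  · exact G.sigmaVar_mem T y w

theorem substCov_htcRow (Z : Set V) (y w : V) [Decidable (y ∈ Z)] :
    G.substCov (G.htcRow Z y w) =
      if y ∈ Z then (G.Omega * (1 - G.Lam)⁻¹) y w else G.covMatrix y w := by
  rw [htcRow]
  split_ifs
  · exact congrFun (congrFun G.map_transpose_mul_sigmaVar y) w
  · exact congrFun (congrFun G.map_sigmaVar y) w

/-- The linear equation for `y`. If `y ∈ htr(v)` it reads Ω_{yv} = 0; otherwise it says that Σ(I-Λ)
vanishes at (y, v). -/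
theorem substCov_htcRow_eq_sum {y v : V} (hyv : y ≠ v) (hadj : ¬ G.bi.Adj y v) :
    G.substCov (G.htcRow (G.htr v) y v) =
      ∑ p, G.substCov (G.htcRow (G.htr v) y p) * G.Lam p v := by
  classical
  simp only [substCov_htcRow]
  have key : ∀ N : Matrix V V (MvPolynomial G.Param ℝ), (N * (1 - G.Lam)) y v = 0 →
      N y v = ∑ p, N y p * G.Lam p v := by
    intro N hN
    rwa [Matrix.mul_sub, Matrix.mul_one, Matrix.sub_apply, sub_eq_zero, Matrix.mul_apply] at hN
  split_ifs with h
  · exact key _ (omega_mul_inv_mul_one_sub_Lam_eq_zero hyv hadj)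
  · exact key _ (covMatrix_mul_one_sub_Lam_eq_zero hyv hadj h)

omit [Fintype V] [DecidableEq V] in
theorem totalDegree_det_le {ι : Type*} [Fintype ι] [DecidableEq ι]
    {M : Matrix ι ι (MvPolynomial G.Var ℝ)} {k : ℕ} (hM : ∀ i j, (M i j).totalDegree ≤ k) :
    M.det.totalDegree ≤ Fintype.card ι * k := by
  rw [Matrix.det_apply]
  refine totalDegree_finsetSum_le fun σ _ => ?_
  rw [Units.smul_def, ← Int.cast_smul_eq_zsmul ℝ]
  refine (totalDegree_smul_le _ _).trans ((totalDegree_finsetProd _ _).trans ?_)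
  exact (Finset.sum_le_card_nsmul _ _ k fun i _ => hM _ _).trans_eq (by simp)

omit [Fintype V] [DecidableEq V] in
theorem det_mem {ι : Type*} [Fintype ι] [DecidableEq ι] {A : Subalgebra ℝ (MvPolynomial G.Var ℝ)}
    {M : Matrix ι ι (MvPolynomial G.Var ℝ)} (hM : ∀ i j, M i j ∈ A) : M.det ∈ A := by
  rw [Matrix.det_apply]
  refine A.sum_mem fun σ _ => ?_
  rw [Units.smul_def]
  exact zsmul_mem (A.prod_mem fun i _ => hM _ _) _

/-- Cramer's rule for the linear system of the half-trek criterion. -/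
theorem SatisfiesHTC.exists_identifying_lambda {v : V} (hY : G.SatisfiesHTC Y v)
    {r : G.Param → G.Param → Prop} {p₀ : V} (hp₀ : G.dir p₀ v)
    (hr : ∀ y ∈ Y ∩ G.htr v, ∀ w, ∀ h : G.dir w y,
      r (Sum.inl ⟨(w, y), h⟩) (Sum.inl ⟨(p₀, v), hp₀⟩)) :
    ∃ g, G.IsIdentifyingPolynomial r (Sum.inl ⟨(p₀, v), hp₀⟩) g ∧
      g.totalDegree ≤ 2 * (G.pa v).ncard + 1 := by
  classical
  obtain ⟨t, ht, htr, hdet⟩ := hY.exists_target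
  obtain ⟨hcard, hdisj, -⟩ := hY
  obtain ⟨y₀, rfl⟩ : p₀ ∈ Set.range t := htr ▸ hp₀
  set M : Matrix Y Y (MvPolynomial G.Var ℝ) :=
    Matrix.of fun y y' => G.htcRow (G.htr v) y (t y') with hM
  set b : Y → MvPolynomial G.Var ℝ := fun y => G.htcRow (G.htr v) y v with hb
  -- Only rows with `y ∈ htr(v)` involve parameters, namely the λ on edges into `y`.
  set T : Set G.Param := {p | ∃ y ∈ Y ∩ G.htr v, ∃ w, ∃ h : G.dir w y, p = Sum.inl ⟨(w, y), h⟩}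
  have hrow : ∀ (y : Y) w, G.htcRow (G.htr v) y w ∈
      supported ℝ (Sum.inl '' T ∪ Set.range Sum.inr : Set G.Var) := fun y w =>
    htcRow_mem (T := T) (fun hy w h => ⟨y, ⟨y.2, hy⟩, w, h, rfl⟩) w
  have hupd : ∀ i j, ∃ w, M.updateCol y₀ b i j = G.htcRow (G.htr v) i w := by
    intro i j
    rw [Matrix.updateCol_apply]
    split_ifs
    exacts [⟨_, rfl⟩, ⟨_, rfl⟩]
  have hMφ : M.map G.substCov = htcMatrix G (G.htr v) t := by
    ext1 y y'
    rw [Matrix.map_apply, hM, Matrix.of_apply, substCov_htcRow, htcMatrix, Matrix.of_apply]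
  have hdetφ : G.substCov M.det = (htcMatrix G (G.htr v) t).det := by
    rw [← hMφ]
    exact G.substCov.toRingHom.map_det M
  have hcramer : G.substCov (M.updateCol y₀ b).det =
      (htcMatrix G (G.htr v) t).det * G.Lam (t y₀) v := by
    have h1 : (htcMatrix G (G.htr v) t).mulVec (fun y => G.Lam (t y) v) =
        fun y => G.substCov (b y) := by
      ext1 y
      rw [hb, substCov_htcRow_eq_sum (hdisj y y.2).1 (hdisj y y.2).2, ← hMφ, Matrix.mulVec,
        dotProduct]
      -- Only parents of `v` contribute to the sum over all nodes, and `t` enumerates them.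
      refine Fintype.sum_of_injective t ht _ _ (fun p hp => ?_) fun y' => rfl
      rw [htr] at hp
      rw [G.Lam_apply_of_not_dir hp, mul_zero]
    have h2 : (M.updateCol y₀ b).map G.substCov =
        (htcMatrix G (G.htr v) t).updateCol y₀ fun y => G.substCov (b y) := by
      rw [Matrix.map_updateCol, hMφ]
      rfl
    have h3 : G.substCov (M.updateCol y₀ b).det = ((M.updateCol y₀ b).map G.substCov).det :=
      G.substCov.toRingHom.map_det _
    rw [h3, h2, ← h1, ← Matrix.cramer_apply, Matrix.cramer_eq_adjugate_mulVec,
      Matrix.mulVec_mulVec, Matrix.adjugate_mul, Matrix.smul_mulVec, Matrix.one_mulVec]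
    rfl
  have hdeg : Fintype.card Y * 2 = 2 * (G.pa v).ncard := by
    rw [← hcard, ← Nat.card_eq_fintype_card, Nat.card_coe_set_eq, mul_comm]
  have hMd : M.det.totalDegree ≤ 2 * (G.pa v).ncard :=
    hdeg ▸ totalDegree_det_le fun i j => totalDegree_htcRow _ _ _
  have hbd : (M.updateCol y₀ b).det.totalDegree ≤ 2 * (G.pa v).ncard := by
    refine hdeg ▸ totalDegree_det_le fun i j => ?_
    obtain ⟨w, hw⟩ := hupd i j
    rw [hw]
    exact totalDegree_htcRow _ _ _
  refine ⟨_, ⟨?_, T, ?_, M.det, det_mem fun i j => hrow i _, (M.updateCol y₀ b).det,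
      det_mem fun i j => ?_, rfl, ?_⟩, ?_⟩
  · rw [mem_graphIdeal_iff, map_sub, map_mul, hcramer, hdetφ, G.Lam_apply_of_dir hp₀, substCov,
      aeval_X, Sum.elim_inl, mul_comm, sub_self]
  · rintro _ ⟨y, hy, w, h, rfl⟩
    exact hr y hy w h
  · obtain ⟨w, hw⟩ := hupd i j
    rw [hw]
    exact hrow i w
  · rw [mem_graphIdeal_iff, hdetφ]
    exact hdet _
  · refine (totalDegree_sub _ _).trans (max_le ?_ (hbd.trans (Nat.le_succ _)))
    refine (totalDegree_mul _ _).trans ?_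
    rw [totalDegree_X, add_comm]
    exact Nat.add_le_add_right hMd 1

/-- The rank of a parameter: `λ_{uv}` has the rank of `v`, and the `ω` come last. -/
def paramRank (f : V → ℕ) (N : ℕ) : G.Param → ℕ :=
  Sum.elim (fun e => f e.1.2) fun _ => N

theorem HTCIdentifiable.exists_identifyingOrder (hG : G.HTCIdentifiable) {s : ℕ} (hs : 1 ≤ s)
    (hpa : ∀ v, (G.pa v).ncard ≤ s) :
    ∃ (r : G.Param → G.Param → Prop) (P : G.Param → MvPolynomial G.Var ℝ),
      G.IsIdentifyingOrderWith r P ∧ ∀ q, (P q).totalDegree ≤ 2 * s + 1 := by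
  obtain ⟨Y, rV, hrV, hY, hlt⟩ := hG
  set f : V → ℕ := fun v => {u | rV u v}.ncard with hf
  have hfmono : ∀ u v, rV u v → f u < f v := by
    intro u v huv
    refine Set.ncard_lt_ncard ⟨fun a ha => _root_.trans ha huv, fun h => ?_⟩ (Set.toFinite _)
    exact irrefl u (h huv)
  set N := Finset.univ.sup f + 1 with hN
  have hfN : ∀ v, f v < N := fun v => Nat.lt_succ_of_le (Finset.le_sup (Finset.mem_univ v))
  -- Parameters of equal rank never need each other, so ties are broken arbitrarily.
  set r : G.Param → G.Param → Prop := fun p q =>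
    Prod.Lex (· < ·) WellOrderingRel (paramRank f N p, p) (paramRank f N q, q) with hr
  have hrank : ∀ p q : G.Param, paramRank f N p < paramRank f N q → r p q := fun p q h =>
    Prod.Lex.left _ _ h
  have hord : IsStrictTotalOrder G.Param r := by
    have hinj : Function.Injective fun p : G.Param => (paramRank f N p, p) := fun p q h =>
      congrArg Prod.snd h
    exact (RelEmbedding.mk ⟨_, hinj⟩ Iff.rfl :
      r ↪r Prod.Lex ((· < ·) : ℕ → ℕ → Prop) WellOrderingRel).isStrictTotalOrder
  have key : ∀ q : G.Param, ∃ g, G.IsIdentifyingPolynomial r q g ∧ g.totalDegree ≤ 2 * s + 1 := by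
    rintro (⟨⟨u, v⟩, huv⟩ | e)
    · obtain ⟨g, hg, hdeg⟩ := (hY v).exists_identifying_lambda (r := r) huv
        fun y hy w h => hrank _ _ (hfmono _ _ (hlt v y hy))
      have := hpa v
      exact ⟨g, hg, by omega⟩
    · obtain ⟨g, hg, hdeg⟩ := G.exists_identifying_omega (r := r) e
        fun p => hrank _ _ (hfN _)
      -- Here `1 ≤ s` is needed, for 3 ≤ 2s+1.
      exact ⟨g, hg, by omega⟩
  choose P hP hdeg using key
  exact ⟨r, P, ⟨hord, hP⟩, hdeg⟩

end MixedGraph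

theorem mainTheorem4 {V : Type u} [Fintype V] [DecidableEq V] (G : MixedGraph V)
    (hG : G.HTCIdentifiable) (s : ℕ) (hs : 1 ≤ s) (hpa : ∀ v, (G.pa v).ncard ≤ s) :
    (∃ (r : G.Param → G.Param → Prop) (P : G.Param → MvPolynomial G.Var ℝ),
      G.IsIdentifyingOrderWith r P ∧ ∀ q, (P q).totalDegree ≤ 2 * s + 1) ∧
    ∀ d : ℕ, 2 * s + 1 ≤ d → ∀ C : G.Choices, C.ReturnsYes d := by
  refine ⟨hG.exists_identifyingOrder hs hpa, fun d hd C => ?_⟩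
  obtain ⟨r, P, hP, hdeg⟩ := hG.exists_identifyingOrder hs hpa
  exact C.returnsYes hP (by omega) fun q => (hdeg q).trans hd
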